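/- Let $F$ be a field of characteristic $p>0$, let $(L,[p])$ be a finite-dimensional restricted Lie algebra over $F$, let $\rho:L\to\mathfrak{gl}(V)$ be an irreducible representation of $L$ over $F$, and let $I\lhd L$ be an ideal with derived algebra $I^{(1)}=[I,I]$. For $S\in L^*$, a representation $\rho$ is an $S$-representation (has character $S$) if $\rho(x)^p-\rho(x^{[p]})=S(x)^p\,\mathrm{id}$ for all $x\in L$, and $u(L,S)$ denotes the quotient of the universal enveloping algebra $U(L)$ by the two-sided ideal generated by all $x^p-x^{[p]}-S(x)^p1$, $x\in L$. If $H\subseteq L$ is a $p$-subalgebra (a subalgebra closed under $[p]$) and $M$ is an $H$-module with character $S|_H$, put $\mathrm{Ind}_H^L(M,S)=u(L,S)\otimes_{u(H,S|_H)}M$, an $L$-module. For $\lambda\in I^*$ with $\lambda(I^{(1)})=0$, let $L^\lambda=\{x\in L:\lambda([x,y])=0\text{ for all }y\in I\}$, which is a $p$-subalgebra of $L$, and $V^\lambda=\{v\in V:\rho(y)v=\lambda(y)v\text{ for all }y\in I\}$, which is an $L^\lambda$-submodule of $V$. (1) Suppose that $\rho$ is an $S$-representation for some $S\in L^*$, and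 that $\lambda\in I^*$ satisfies $\lambda(I^{(1)})=0$ and $V^\lambda\neq 0$. Then $V\cong\mathrm{Ind}_{L^\lambda}^L(V^\lambda,S)$ as $L$-modules, and $V^\lambda$ is an irreducible $L^\lambda$-module. (2) Suppose that $F$ is algebraically closed and that every element of $I^{(1)}$ acts nilpotently on $V$. Then there exist $S\in L^*$ such that $\rho$ is an $S$-representation and $\lambda\in I^*$ with $\lambda(I^{(1)})=0$ and $V^\lambda\neq 0$ such that $V\cong\mathrm{Ind}_{L^\lambda}^L(V^\lambda,S)$ as $L$-modules and $V^\lambda$ is an irreducible $L^\lambda$-module. -/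

import Mathlib

open scoped TensorProduct

noncomputable section

namespace RestrictedLie

attribute [local instance 100] LieRing.ofAssociativeRing

universe u v w

section PMap

variable (F : Type u) [Field F] (p : ℕ) {L : Type v} [LieRing L] [LieAlgebra F L]

/-- The element `s_i(a, b)` of `L`: `i * s_i(a, b)` is the coefficient of `X ^ (i - 1)` in
`(ad (a ⊗ X + b ⊗ 1)) ^ (p - 1) (a ⊗ 1)`, an element of `F[X] ⊗ L`. It is used for `1 ≤ i ≤ p - 1`
in characteristic `p` only, where `i` is invertible in `F`. -/
def jacobsonCoeff (i : ℕ) (a b : L) : L :=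
  (i : F)⁻¹ • TensorProduct.lid F L
    (LinearMap.rTensor L (Polynomial.lcoeff F (i - 1))
      (((LieAlgebra.ad (Polynomial F) (Polynomial F ⊗[F] L)
          ((Polynomial.X : Polynomial F) ⊗ₜ[F] a + (1 : Polynomial F) ⊗ₜ[F] b)) ^ (p - 1))
        ((1 : Polynomial F) ⊗ₜ[F] a)))

variable (L) in
/-- A `p`-mapping on a Lie algebra `L` over `F`. A Lie algebra over a field of characteristic `p`
with a `p`-mapping is a restricted Lie algebra. -/
structure PMapping where
  /-- the map `x ↦ x^{[p]}` -/
  toFun : L → L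
  ad_toFun : ∀ a : L, LieAlgebra.ad F L (toFun a) = (LieAlgebra.ad F L a) ^ p
  map_smul : ∀ (α : F) (a : L), toFun (α • a) = α ^ p • toFun a
  map_add : ∀ a b : L, toFun (a + b) =
    toFun a + toFun b + ∑ i ∈ Finset.Icc 1 (p - 1), jacobsonCoeff F p i a b

variable {F p}

/-- `H` is a `p`-subalgebra: a subalgebra closed under the `p`-mapping. -/
def IsPSubalgebra (P : PMapping F p L) (H : LieSubalgebra F L) : Prop :=
  ∀ x ∈ H, P.toFun x ∈ H

theorem map_jacobsonCoeff {L' : Type w} [LieRing L'] [LieAlgebra F L'] (f : L →ₗ⁅F⁆ L')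
    (i : ℕ) (a b : L) :
    f (jacobsonCoeff F p i a b) = jacobsonCoeff F p i (f a) (f b) := by
  have key : ∀ (n : ℕ) (z w : Polynomial F ⊗[F] L),
      LieAlgebra.ExtendScalars.map (AlgHom.id F (Polynomial F)) f
        (((LieAlgebra.ad (Polynomial F) (Polynomial F ⊗[F] L) z) ^ n) w) =
      ((LieAlgebra.ad (Polynomial F) (Polynomial F ⊗[F] L')
        (LieAlgebra.ExtendScalars.map (AlgHom.id F (Polynomial F)) f z)) ^ n)
        (LieAlgebra.ExtendScalars.map (AlgHom.id F (Polynomial F)) f w) := by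
    intro n z w
    induction n with
    | zero => simp
    | succ n ih =>
      rw [pow_succ', pow_succ', Module.End.mul_apply, Module.End.mul_apply, ← ih,
        LieAlgebra.ad_apply, LieAlgebra.ad_apply, LieHom.map_lie]
  have hl : ∀ (j : ℕ) (t : Polynomial F ⊗[F] L),
      f (TensorProduct.lid F L (LinearMap.rTensor L (Polynomial.lcoeff F j) t)) =
      TensorProduct.lid F L' (LinearMap.rTensor L' (Polynomial.lcoeff F j)
        (LieAlgebra.ExtendScalars.map (AlgHom.id F (Polynomial F)) f t)) := by
    intro j t
    induction t with
    | zero => simp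
    | tmul q x =>
      have h : LieAlgebra.ExtendScalars.map (AlgHom.id F (Polynomial F)) f (q ⊗ₜ[F] x)
          = q ⊗ₜ[F] f x := rfl
      rw [h]
      simp
    | add s t hs ht => simp only [map_add, hs, ht]
  have e1 : ∀ (q : Polynomial F) (x : L),
      LieAlgebra.ExtendScalars.map (AlgHom.id F (Polynomial F)) f (q ⊗ₜ[F] x)
        = q ⊗ₜ[F] f x := fun _ _ => rfl
  unfold jacobsonCoeff
  rw [map_smul, hl, key, map_add, e1, e1, e1]

/-- The restriction of the `p`-mapping to a `p`-subalgebra. -/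
def PMapping.restrict (P : PMapping F p L) (H : LieSubalgebra F L) (hH : IsPSubalgebra P H) :
    PMapping F p H where
  toFun x := ⟨P.toFun x, hH x x.2⟩
  ad_toFun a := by
    have key : ∀ (n : ℕ) (y : H), ((((LieAlgebra.ad F H a) ^ n) y : H) : L) =
        ((LieAlgebra.ad F L (a : L)) ^ n) (y : L) := by
      intro n y
      induction n with
      | zero => simp
      | succ n ih =>
        rw [pow_succ', pow_succ', Module.End.mul_apply, Module.End.mul_apply, ← ih]
        rfl
    ext y
    rw [key, ← P.ad_toFun]
    rfl
  map_smul α a := Subtype.ext (P.map_smul α a)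
  map_add a b := by
    apply Subtype.ext
    have h : ∀ i, ((jacobsonCoeff F p i a b : H) : L) = jacobsonCoeff F p i (a : L) (b : L) :=
      fun i => map_jacobsonCoeff H.incl i a b
    have hs : ((∑ i ∈ Finset.Icc 1 (p - 1), jacobsonCoeff F p i a b : H) : L) =
        ∑ i ∈ Finset.Icc 1 (p - 1), jacobsonCoeff F p i (a : L) (b : L) := by
      rw [← Finset.sum_congr rfl fun i _ => h i]
      exact map_sum (H.incl : H →ₗ[F] L) _ _
    change P.toFun ((a : L) + b) = P.toFun a + P.toFun b + _
    rw [P.map_add, hs]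

end PMap

section SRep

variable {F : Type u} [Field F] {p : ℕ} {L : Type v} [LieRing L] [LieAlgebra F L]

/-- `V` is an `S`-representation (has character `S`):
`ρ(x) ^ p - ρ(x^{[p]}) = S(x) ^ p • id` for all `x`. -/
def IsSRepresentation (P : PMapping F p L) (S : Module.Dual F L) (V : Type w) [AddCommGroup V]
    [Module F V] [LieRingModule L V] [LieModule F L V] : Prop :=
  ∀ x : L, (LieModule.toEnd F L V x) ^ p - LieModule.toEnd F L V (P.toFun x) =
    (S x) ^ p • (1 : Module.End F V)

/-- The restriction of a linear form to a subalgebra. -/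
def restrictForm (S : Module.Dual F L) (H : LieSubalgebra F L) : Module.Dual F H :=
  S ∘ₗ (H.incl : H →ₗ[F] L)

/-- The relations `x ^ p - x^{[p]} = S(x) ^ p` imposed on `U(L)`. -/
inductive ReducedRel (P : PMapping F p L) (S : Module.Dual F L) :
    UniversalEnvelopingAlgebra F L → UniversalEnvelopingAlgebra F L → Prop
  | char_compat (x : L) : ReducedRel P S
      ((UniversalEnvelopingAlgebra.ι F x) ^ p - UniversalEnvelopingAlgebra.ι F (P.toFun x))
      (algebraMap F (UniversalEnvelopingAlgebra F L) ((S x) ^ p))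

/-- The `S`-reduced universal enveloping algebra `u(L, S)`: the quotient of `U(L)` by the
two-sided ideal generated by all `x ^ p - x^{[p]} - S(x) ^ p`. -/
abbrev ReducedEnveloping (P : PMapping F p L) (S : Module.Dual F L) : Type _ :=
  RingQuot (ReducedRel P S)

namespace ReducedEnveloping

/-- The canonical Lie homomorphism `L → u(L, S)`. -/
def ι (P : PMapping F p L) (S : Module.Dual F L) : L →ₗ⁅F⁆ ReducedEnveloping P S :=
  (RingQuot.mkAlgHom F (ReducedRel P S)).toLieHom.comp (UniversalEnvelopingAlgebra.ι F)

theorem ι_pow_sub (P : PMapping F p L) (S : Module.Dual F L) (x : L) :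
    (ι P S x) ^ p - ι P S (P.toFun x) = algebraMap F (ReducedEnveloping P S) ((S x) ^ p) := by
  have h := RingQuot.mkAlgHom_rel F (ReducedRel.char_compat (P := P) (S := S) x)
  rw [map_sub, map_pow, AlgHom.commutes] at h
  exact h

/-- The universal property of `u(L, S)`. -/
def lift (P : PMapping F p L) (S : Module.Dual F L) {A : Type w} [Ring A] [Algebra F A]
    (f : L →ₗ⁅F⁆ A) (hf : ∀ x, (f x) ^ p - f (P.toFun x) = algebraMap F A ((S x) ^ p)) :
    ReducedEnveloping P S →ₐ[F] A :=
  RingQuot.liftAlgHom F ⟨UniversalEnvelopingAlgebra.lift F f, by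
    intro a b h
    induction h with
    | char_compat x =>
      rw [map_sub, map_pow, AlgHom.commutes]
      simpa only [UniversalEnvelopingAlgebra.lift_ι_apply] using hf x⟩

theorem lift_ι (P : PMapping F p L) (S : Module.Dual F L) {A : Type w} [Ring A] [Algebra F A]
    (f : L →ₗ⁅F⁆ A) (hf : ∀ x, (f x) ^ p - f (P.toFun x) = algebraMap F A ((S x) ^ p)) (x : L) :
    lift P S f hf (ι P S x) = f x := by
  change RingQuot.liftAlgHom F _ (RingQuot.mkAlgHom F _ (UniversalEnvelopingAlgebra.ι F x)) = _
  rw [RingQuot.liftAlgHom_mkAlgHom_apply]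
  exact UniversalEnvelopingAlgebra.lift_ι_apply F f x

/-- The action of `u(L, S)` on an `L`-module with character `S`. -/
def act (P : PMapping F p L) (S : Module.Dual F L) (V : Type w) [AddCommGroup V]
    [Module F V] [LieRingModule L V] [LieModule F L V] (hV : IsSRepresentation P S V) :
    ReducedEnveloping P S →ₐ[F] Module.End F V :=
  lift P S (LieModule.toEnd F L V) fun x => by
    rw [hV x, Algebra.algebraMap_eq_smul_one]

/-- The canonical homomorphism `u(H, S|_H) → u(L, S)` for a `p`-subalgebra `H`. -/
def incl (P : PMapping F p L) (S : Module.Dual F L) (H : LieSubalgebra F L)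
    (hH : IsPSubalgebra P H) :
    ReducedEnveloping (P.restrict H hH) (restrictForm S H) →ₐ[F] ReducedEnveloping P S :=
  lift (P.restrict H hH) (restrictForm S H) ((ι P S).comp H.incl) fun x => ι_pow_sub P S x

end ReducedEnveloping

section Ind

variable (P : PMapping F p L) (S : Module.Dual F L) (H : LieSubalgebra F L)
  (hH : IsPSubalgebra P H) (M : Type w) [AddCommGroup M] [Module F M] [LieRingModule H M]
  [LieModule F H M] (hM : IsSRepresentation (P.restrict H hH) (restrictForm S H) M)

/-- The relations `a h ⊗ m = a ⊗ h m`, for `a ∈ u(L, S)`, `h ∈ u(H, S|_H)` and `m ∈ M`, that cut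
`u(L, S) ⊗_{u(H, S|_H)} M` out of `u(L, S) ⊗_F M`. Their linear span is stable under left
multiplication by `u(L, S)`. -/
def balancedRelations :
    Submodule (ReducedEnveloping P S) (ReducedEnveloping P S ⊗[F] M) :=
  Submodule.span (ReducedEnveloping P S)
    {t | ∃ (a : ReducedEnveloping P S)
        (h : ReducedEnveloping (P.restrict H hH) (restrictForm S H)) (m : M),
      t = (a * ReducedEnveloping.incl P S H hH h) ⊗ₜ[F] m
        - a ⊗ₜ[F] (ReducedEnveloping.act (P.restrict H hH) (restrictForm S H) M hM h m)}

/-- The induced module `Ind_H^L(M, S) = u(L, S) ⊗_{u(H, S|_H)} M`. -/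
def Ind : Type _ :=
  (ReducedEnveloping P S ⊗[F] M) ⧸ balancedRelations P S H hH M hM

namespace Ind

instance : AddCommGroup (Ind P S H hH M hM) :=
  inferInstanceAs (AddCommGroup (_ ⧸ balancedRelations P S H hH M hM))

instance : Module (ReducedEnveloping P S) (Ind P S H hH M hM) :=
  inferInstanceAs (Module (ReducedEnveloping P S) (_ ⧸ balancedRelations P S H hH M hM))

instance : Module F (Ind P S H hH M hM) :=
  inferInstanceAs (Module F (_ ⧸ balancedRelations P S H hH M hM))

instance : IsScalarTower F (ReducedEnveloping P S) (Ind P S H hH M hM) :=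
  inferInstanceAs
    (IsScalarTower F (ReducedEnveloping P S) (_ ⧸ balancedRelations P S H hH M hM))

/-- `L` acts on the induced module through `L → u(L, S)`. -/
instance : LieRingModule L (Ind P S H hH M hM) where
  bracket x v := ReducedEnveloping.ι P S x • v
  add_lie x y v := by
    change ReducedEnveloping.ι P S (x + y) • v = _
    rw [map_add, add_smul]
  lie_add x v w := smul_add _ v w
  leibniz_lie x y v := by
    change ReducedEnveloping.ι P S x • ReducedEnveloping.ι P S y • v =
      ReducedEnveloping.ι P S ⁅x, y⁆ • v +
        ReducedEnveloping.ι P S y • ReducedEnveloping.ι P S x • v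
    rw [LieHom.map_lie, LieRing.of_associative_ring_bracket, sub_smul, mul_smul, mul_smul,
      sub_add_cancel]

theorem lie_def (x : L) (v : Ind P S H hH M hM) : ⁅x, v⁆ = ReducedEnveloping.ι P S x • v := rfl

instance : LieModule F L (Ind P S H hH M hM) where
  smul_lie c x v := by
    rw [lie_def, lie_def, map_smul, smul_assoc]
  lie_smul c x v := by
    rw [lie_def, lie_def, ← algebraMap_smul (ReducedEnveloping P S) c v,
      ← algebraMap_smul (ReducedEnveloping P S) c (ReducedEnveloping.ι P S x • v),
      ← mul_smul, ← mul_smul, Algebra.commutes]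

end Ind

end Ind

section Eigen

variable {I : LieIdeal F L}

/-- `λ(I^{(1)}) = 0`, where `I^{(1)} = [I, I]` is the derived algebra of `I`. -/
def VanishesOnDerived (lam : Module.Dual F I) : Prop :=
  ∀ y ∈ LieAlgebra.derivedSeries F I 1, lam y = 0

/-- `L^λ = {x ∈ L | λ([x, y]) = 0 for all y ∈ I}`. -/
def stabilizer (lam : Module.Dual F I) : LieSubalgebra F L where
  carrier := {x | ∀ y : I, lam ⁅x, y⁆ = 0}
  zero_mem' y := by simp
  add_mem' {a b} ha hb y := by
    have h1 := ha y
    have h2 := hb y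
    simp [h1, h2]
  smul_mem' c x hx y := by
    have h1 := hx y
    simp [h1]
  lie_mem' {a b} ha hb y := by
    have h1 := ha ⁅b, y⁆
    have h2 := hb ⁅a, y⁆
    rw [lie_lie, map_sub, h1, h2, sub_zero]

theorem mem_stabilizer (lam : Module.Dual F I) (x : L) :
    x ∈ stabilizer lam ↔ ∀ y : I, lam ⁅x, y⁆ = 0 := Iff.rfl

/-- `L^λ` is a `p`-subalgebra. -/
theorem stabilizer_isPSubalgebra [Fact p.Prime] (P : PMapping F p L) (lam : Module.Dual F I) :
    IsPSubalgebra P (stabilizer lam) := by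
  intro x hx y
  have key : ∀ n : ℕ, ∃ z : I, (z : L) = ((LieAlgebra.ad F L x) ^ n) (y : L) := by
    intro n
    induction n with
    | zero => exact ⟨y, by simp⟩
    | succ n ih =>
      obtain ⟨z, hz⟩ := ih
      exact ⟨⁅x, z⁆, by rw [pow_succ', Module.End.mul_apply, ← hz]; rfl⟩
  obtain ⟨z, hz⟩ := key (p - 1)
  have hp : p = (p - 1) + 1 := (Nat.succ_pred_prime (Fact.out : p.Prime)).symm
  have e : ⁅P.toFun x, y⁆ = ⁅x, z⁆ := by
    apply Subtype.ext
    change ⁅P.toFun x, (y : L)⁆ = ⁅x, (z : L)⁆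
    change LieAlgebra.ad F L (P.toFun x) (y : L) = LieAlgebra.ad F L x (z : L)
    rw [P.ad_toFun, hz, ← Module.End.mul_apply, ← pow_succ', ← hp]
  rw [e]
  exact hx z

/-- `V^λ = {v ∈ V | y v = λ(y) v for all y ∈ I}`, an `L^λ`-submodule of `V`. -/
def eigenspace (lam : Module.Dual F I) (V : Type w) [AddCommGroup V] [Module F V]
    [LieRingModule L V] [LieModule F L V] : LieSubmodule F (stabilizer lam) V where
  carrier := {v | ∀ y : I, ⁅(y : L), v⁆ = lam y • v}
  zero_mem' y := by simp
  add_mem' {a b} ha hb y := by rw [lie_add, ha y, hb y, smul_add]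
  smul_mem' c v hv y := by rw [lie_smul, hv y, smul_comm]
  lie_mem {x v} hv y := by
    have h1 : ⁅⁅(x : L), (y : L)⁆, v⁆ = 0 := by
      have h := hv ⁅(x : L), y⁆
      rw [x.2 y, zero_smul] at h
      exact h
    change ⁅(y : L), ⁅(x : L), v⁆⁆ = lam y • ⁅(x : L), v⁆
    rw [← lie_smul, ← hv y, leibniz_lie (x : L) (y : L) v, h1, zero_add]

/-- If `V` has character `S`, then `V^λ` has character `S|_{L^λ}`. -/
theorem eigenspace_isSRepresentation [Fact p.Prime] (P : PMapping F p L) (S : Module.Dual F L)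
    (lam : Module.Dual F I) (V : Type w) [AddCommGroup V] [Module F V] [LieRingModule L V]
    [LieModule F L V] (hV : IsSRepresentation P S V) :
    IsSRepresentation (P.restrict (stabilizer lam) (stabilizer_isPSubalgebra P lam))
      (restrictForm S (stabilizer lam)) (eigenspace lam V) := by
  intro x
  have key : ∀ (n : ℕ) (v : eigenspace lam V),
      ((((LieModule.toEnd F (stabilizer lam) (eigenspace lam V) x) ^ n) v :
        eigenspace lam V) : V) = ((LieModule.toEnd F L V (x : L)) ^ n) (v : V) := by
    intro n v
    induction n with
    | zero => simp
    | succ n ih =>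
      rw [pow_succ', pow_succ', Module.End.mul_apply, Module.End.mul_apply, ← ih]
      rfl
  ext v
  have h := LinearMap.congr_fun (hV (x : L)) (v : V)
  rw [LinearMap.sub_apply, ← key] at h
  exact h

/-- The module `Ind_{L^λ}^L(V^λ, S)`. -/
abbrev IndEigenspace [Fact p.Prime] (P : PMapping F p L) (S : Module.Dual F L)
    (lam : Module.Dual F I) (V : Type w) [AddCommGroup V] [Module F V] [LieRingModule L V]
    [LieModule F L V] (hV : IsSRepresentation P S V) : Type _ :=
  Ind P S (stabilizer lam) (stabilizer_isPSubalgebra P lam) (eigenspace lam V)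
    (eigenspace_isSRepresentation P S lam V hV)

end Eigen

end SRep

end RestrictedLie

end

noncomputable section

namespace RestrictedLie

attribute [local instance 100] LieRing.ofAssociativeRing

universe u v w

/-! ### Jacobson's formula for p-th powers of sums in associative algebras -/

section Jacobson

/-! Both claims of (1) follow from one fact. Let N be an L-module with character S, generated by a
subspace W that is stable under L^λ and on which I acts through λ. Then every vector of N on which I
acts through λ lies in W (`mem_of_shiftedOp_eq_zero`).

To see this, choose a basis e_i of a complement of L^λ and y_i in I with λ([e_j, y_i]) = δ_ij, and
filter N by the number of factors from L applied to W. Each λ(y) - y lowers the degree, and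
e_i(λ(y_i) - y_i) multiplies a monomial in the e_j by the multiplicity of e_i, up to lower degree.
The p-th power relation removes multiplicities ≥ p, so a surviving monomial of positive degree has
some multiplicity that is nonzero in F. A vector killed by all λ(y) - y therefore has degree zero.
No PBW basis is needed.

Irreducibility of V^λ: a nonzero L^λ-submodule of V^λ generates V, hence is V^λ. Induction: Ind → V
is onto because V is irreducible. A nonzero kernel would be I-stable, so a vector of least degree in
it would be a λ-eigenvector. That vector lies in the copy of V^λ, where the map is injective.

For (2), the operators x^p - x^{[p]} commute with L and depend p-semilinearly on x. They generate a
commutative F-algebra K of finite type, V is finite over K, and Nakayama makes K a field. By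
Zariski's lemma K = F, so S exists and V is finite-dimensional. Engel's theorem and irreducibility
make I^{(1)} act by zero, and a common eigenvector of the commuting operators from I supplies λ. -/

theorem neg_one_pow_mul_choose_pred (R : Type*) [Ring R] (p : ℕ) [Fact p.Prime] [CharP R p]
    {i : ℕ} (hi : i < p) : (-1 : R) ^ i * ((p - 1).choose i : R) = 1 := by
  have hp : p = (p - 1) + 1 := (Nat.succ_pred_prime (Fact.out : p.Prime)).symm
  induction i with
  | zero => simp
  | succ i ih =>
    have h1 : ((p.choose (i + 1) : ℕ) : R) = 0 :=
      (CharP.cast_eq_zero_iff R p _).2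
        ((Fact.out : p.Prime).dvd_choose_self (Nat.succ_ne_zero i) hi)
    rw [hp, Nat.choose_succ_succ, Nat.cast_add] at h1
    have h2 : (((p - 1).choose (i + 1) : ℕ) : R) = -((p - 1).choose i : R) :=
      eq_neg_of_add_eq_zero_right h1
    rw [h2, pow_succ, mul_neg_one, neg_mul_neg, ih (Nat.lt_of_succ_lt hi)]

/-- In characteristic `p`, `(x - y) ^ (p - 1) = ∑ x ^ i y ^ (p - 1 - i)` for commuting `x`, `y`. -/
theorem sub_pow_char_pred {R : Type*} [Ring R] (p : ℕ) [Fact p.Prime] [CharP R p] {x y : R}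
    (h : Commute x y) :
    (x - y) ^ (p - 1) = ∑ i ∈ Finset.range p, x ^ i * y ^ (p - 1 - i) := by
  have hp : p = (p - 1) + 1 := (Nat.succ_pred_prime (Fact.out : p.Prime)).symm
  rw [sub_eq_add_neg, (h.neg_right).add_pow, ← hp]
  refine Finset.sum_congr rfl fun i hi => ?_
  have hi' : i < p := Finset.mem_range.1 hi
  rw [← Nat.choose_symm (show i ≤ p - 1 by omega), neg_pow, mul_assoc, mul_assoc,
    ← Nat.cast_commute, ← mul_assoc ((-1 : R) ^ _),
    neg_one_pow_mul_choose_pred R p (show p - 1 - i < p by omega), one_mul]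

/-- `ad q` is the difference of left and right multiplication by `q`, which commute, so the
expansion of `(x - y) ^ (p - 1)` applies. -/
theorem ad_pow_char_pred {R : Type*} [CommRing R] {B : Type*} [Ring B] [Algebra R B] (p : ℕ)
    [Fact p.Prime] [CharP B p] (q c : B) :
    ((LieAlgebra.ad R B q) ^ (p - 1)) c =
      ∑ i ∈ Finset.range p, q ^ i * c * q ^ (p - 1 - i) := by
  have hE : CharP (Module.End ℤ B) p := by
    refine ⟨fun n => ⟨fun hn => ?_, fun hn => ?_⟩⟩
    · have := LinearMap.congr_fun hn (1 : B)
      exact (CharP.cast_eq_zero_iff B p n).1 (by simpa using this)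
    · ext b
      have := (CharP.cast_eq_zero_iff B p n).2 hn
      simp [this]
  have key : ∀ (n : ℕ) (b : B), ((LieAlgebra.ad R B q) ^ n) b =
      ((LinearMap.mulLeft ℤ q - LinearMap.mulRight ℤ q) ^ n) b := by
    intro n
    induction n with
    | zero => intro b; simp
    | succ n ih =>
      intro b
      rw [pow_succ, pow_succ, Module.End.mul_apply, Module.End.mul_apply, ih]
      rfl
  have hcomm : Commute (LinearMap.mulLeft ℤ q) (LinearMap.mulRight ℤ q) :=
    LinearMap.ext fun b => (mul_assoc q b q).symm
  rw [key, sub_pow_char_pred p hcomm, LinearMap.sum_apply]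
  refine Finset.sum_congr rfl fun i _ => ?_
  rw [LinearMap.pow_mulLeft, LinearMap.pow_mulRight]
  simp [mul_assoc]

theorem derivative_pow_eq_sum {B : Type*} [Ring B] (q : Polynomial B) (n : ℕ) :
    Polynomial.derivative (q ^ n) =
      ∑ i ∈ Finset.range n, q ^ i * Polynomial.derivative q * q ^ (n - 1 - i) := by
  induction n with
  | zero => simp
  | succ n ih =>
    rw [pow_succ, Polynomial.derivative_mul, ih, Finset.sum_range_succ, Finset.sum_mul]
    simp only [Nat.add_sub_cancel, Nat.sub_self, pow_zero, mul_one]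
    congr 1
    refine Finset.sum_congr rfl fun i hi => ?_
    have : n - i = (n - 1 - i) + 1 := by have := Finset.mem_range.1 hi; omega
    rw [this, pow_succ, mul_assoc, mul_assoc]

variable (F : Type u) [Field F] (p : ℕ) {A : Type v} [Ring A] [Algebra F A]

/-- The homomorphism `F[X] ⊗ A → A[X]`. -/
def tensorToPolynomial : Polynomial F ⊗[F] A →ₐ[F] Polynomial A :=
  Algebra.TensorProduct.lift (Polynomial.mapAlgHom (Algebra.ofId F A))
    (Polynomial.CAlgHom : A →ₐ[F] Polynomial A) (by
      intro q a
      change Polynomial.map _ q * Polynomial.C a = Polynomial.C a * Polynomial.map _ q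
      ext n
      simp only [Polynomial.coeff_mul_C, Polynomial.coeff_C_mul, Polynomial.coeff_map]
      exact Algebra.commutes _ _)

theorem tensorToPolynomial_tmul (q : Polynomial F) (a : A) :
    tensorToPolynomial F (q ⊗ₜ[F] a) = q.map (algebraMap F A) * Polynomial.C a := by
  rw [tensorToPolynomial, Algebra.TensorProduct.lift_tmul]
  rfl

theorem tensorToPolynomial_lie (z w : Polynomial F ⊗[F] A) :
    tensorToPolynomial F (LieAlgebra.ad (Polynomial F) (Polynomial F ⊗[F] A) z w) =
      tensorToPolynomial F z * tensorToPolynomial F w -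
        tensorToPolynomial F w * tensorToPolynomial F z := by
  rw [← map_mul, ← map_mul, ← map_sub]
  congr 1
  rw [LieAlgebra.ad_apply]
  induction z with
  | zero => simp
  | add s t hs ht => rw [add_lie, hs, ht, add_mul, mul_add]; abel
  | tmul q a =>
    induction w with
    | zero => simp
    | add s t hs ht => rw [lie_add, hs, ht, add_mul, mul_add]; abel
    | tmul r b =>
      rw [LieAlgebra.ExtendScalars.bracket_tmul, LieRing.of_associative_ring_bracket,
        Algebra.TensorProduct.tmul_mul_tmul, Algebra.TensorProduct.tmul_mul_tmul,
        TensorProduct.tmul_sub, mul_comm r q]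

theorem tensorToPolynomial_coeff (t : Polynomial F ⊗[F] A) (j : ℕ) :
    (tensorToPolynomial F t).coeff j =
      TensorProduct.lid F A (LinearMap.rTensor A (Polynomial.lcoeff F j) t) := by
  induction t with
  | zero => simp
  | add s t hs ht => simp only [map_add, Polynomial.coeff_add, hs, ht]
  | tmul q a =>
    rw [tensorToPolynomial_tmul, Polynomial.coeff_mul_C, Polynomial.coeff_map]
    simp [Algebra.smul_def]

variable [Fact p.Prime] [CharP F p]

/-- With `q = aX + b`, the noncommutative Leibniz rule gives (q^p)' = ∑ q^j a q^(p-1-j) = (ad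
q)^(p-1)(a). Compare coefficients of X^(i-1) and divide by `i`. -/
theorem coeff_linear_pow_char (a b : A) {i : ℕ} (hi : i ∈ Finset.Icc 1 (p - 1)) :
    ((Polynomial.C a * Polynomial.X + Polynomial.C b : Polynomial A) ^ p).coeff i =
      jacobsonCoeff F p i a b := by
  nontriviality A
  have hA : CharP A p := charP_of_injective_algebraMap (algebraMap F A).injective p
  have hi' := Finset.mem_Icc.1 hi
  set q : Polynomial A := Polynomial.C a * Polynomial.X + Polynomial.C b with hq
  have hz : tensorToPolynomial F
      ((Polynomial.X : Polynomial F) ⊗ₜ[F] a + (1 : Polynomial F) ⊗ₜ[F] b) = q := by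
    rw [map_add, tensorToPolynomial_tmul, tensorToPolynomial_tmul, Polynomial.map_X,
      Polynomial.map_one, one_mul, Polynomial.X_mul_C]
  have hpow : ∀ (n : ℕ) (w : Polynomial F ⊗[F] A), tensorToPolynomial F
      (((LieAlgebra.ad (Polynomial F) (Polynomial F ⊗[F] A)
          ((Polynomial.X : Polynomial F) ⊗ₜ[F] a + (1 : Polynomial F) ⊗ₜ[F] b)) ^ n) w) =
      ((LieAlgebra.ad ℤ (Polynomial A) q) ^ n) (tensorToPolynomial F w) := by
    intro n
    induction n with
    | zero => intro w; simp
    | succ n ih =>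
      intro w
      rw [pow_succ, pow_succ, Module.End.mul_apply, Module.End.mul_apply, ih,
        tensorToPolynomial_lie, hz]
      rfl
  have hd : Polynomial.derivative q = Polynomial.C a := by simp [hq]
  have h1 := derivative_pow_eq_sum q p
  rw [hd, ← ad_pow_char_pred (R := ℤ) p q (Polynomial.C a)] at h1
  have h2 : tensorToPolynomial F ((1 : Polynomial F) ⊗ₜ[F] a) = Polynomial.C a := by
    rw [tensorToPolynomial_tmul, Polynomial.map_one, one_mul]
  have h3 := congrArg (fun r => Polynomial.coeff r (i - 1)) h1
  simp only [Polynomial.coeff_derivative] at h3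
  rw [← h2, ← hpow, tensorToPolynomial_coeff, Nat.sub_add_cancel hi'.1] at h3
  unfold jacobsonCoeff
  rw [← h3]
  have h4 : ((i - 1 : ℕ) : A) + 1 = algebraMap F A (i : F) := by
    rw [map_natCast, ← Nat.cast_succ, Nat.succ_eq_add_one, Nat.sub_add_cancel hi'.1]
  have h5 : (i : F) ≠ 0 := by
    rw [Ne, CharP.cast_eq_zero_iff F p]
    intro h
    have := Nat.le_of_dvd (by omega) h
    omega
  rw [h4, ← Algebra.commutes, ← Algebra.smul_def, smul_smul, inv_mul_cancel₀ h5, one_smul]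

/-- Jacobson's formula in an associative algebra of characteristic `p`. -/
theorem add_pow_char_eq_jacobson (a b : A) :
    (a + b) ^ p = a ^ p + b ^ p + ∑ i ∈ Finset.Icc 1 (p - 1), jacobsonCoeff F p i a b := by
  have hp : 2 ≤ p := (Fact.out : p.Prime).two_le
  set q : Polynomial A := Polynomial.C a * Polynomial.X + Polynomial.C b with hq
  have heval : ∀ n, Polynomial.eval 1 (q ^ n) = (a + b) ^ n := by
    intro n
    have h := map_pow (Polynomial.eval₂RingHom' (RingHom.id A) (1 : A)
      (fun x => Commute.one_right x)) q n
    change Polynomial.eval 1 (q ^ n) = (Polynomial.eval 1 q) ^ n at h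
    rw [h, hq]
    simp
  have hdeg : q.natDegree ≤ 1 := Polynomial.natDegree_linear_le
  have hdp : (q ^ p).natDegree < p + 1 :=
    Nat.lt_succ_of_le ((Polynomial.natDegree_pow_le).trans (by nlinarith))
  have htop : (q ^ p).coeff p = a ^ p := by
    have h := Polynomial.coeff_pow_of_natDegree_le (n := 1) (m := p) hdeg
    rw [mul_one] at h
    rw [h, hq]
    simp
  have h0 : (q ^ p).coeff 0 = b ^ p := by
    have h : ∀ n, (q ^ n).coeff 0 = b ^ n := by
      intro n
      induction n with
      | zero => simp
      | succ n ih => rw [pow_succ, Polynomial.mul_coeff_zero, ih, pow_succ]; simp [hq]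
    exact h p
  -- Evaluation at X = 1 adds up the coefficients of (aX + b)^p; the extreme ones are `b ^ p` and `a
  -- ^ p`.
  rw [← heval, Polynomial.eval_eq_sum_range' hdp]
  simp only [one_pow, mul_one]
  rw [Finset.sum_range_succ, htop, Finset.range_eq_Ico,
    Finset.sum_eq_sum_Ico_succ_bot (by omega), h0, zero_add]
  have : Finset.Ico 1 p = Finset.Icc 1 (p - 1) := by ext; simp; omega
  rw [this, Finset.sum_congr rfl fun i hi => coeff_linear_pow_char F p a b hi]
  abel

end Jacobson

/-! ### The degree filtration of a module generated by a subspace -/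

section Filtration

variable {F : Type*} [Field F] {K : Type*} [CommRing K] [Algebra F K] {L : Type*} [LieRing L]
  [LieAlgebra F L] {N : Type*} [AddCommGroup N] [Module F N] [Module K N] [IsScalarTower F K N]
  (f : L →ₗ[F] Module.End K N) (W : Submodule K N)

/-- `degreeFiltration f W (k + 1)` is spanned by the products of at most `k` elements of `L`
applied to elements of `W`. -/
def degreeFiltration : ℕ → Submodule K N
  | 0 => ⊥
  | k + 1 => W ⊔ ⨆ x : L, (degreeFiltration k).map (f x)

variable {f W}

theorem le_degreeFiltration_succ (k : ℕ) : W ≤ degreeFiltration f W (k + 1) := le_sup_left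

theorem apply_mem_degreeFiltration {k : ℕ} {n : N} (hn : n ∈ degreeFiltration f W k) (x : L) :
    f x n ∈ degreeFiltration f W (k + 1) :=
  Submodule.mem_sup_right (Submodule.mem_iSup_of_mem x (Submodule.mem_map_of_mem hn))

theorem degreeFiltration_succ_le {k : ℕ} {Q : Submodule K N} (hW : W ≤ Q)
    (h : ∀ (x : L), ∀ n ∈ degreeFiltration f W k, f x n ∈ Q) :
    degreeFiltration f W (k + 1) ≤ Q :=
  sup_le hW (iSup_le fun x => Submodule.map_le_iff_le_comap.2 fun n hn => h x n hn)

theorem degreeFiltration_le_succ (k : ℕ) :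
    degreeFiltration f W k ≤ degreeFiltration f W (k + 1) := by
  induction k with
  | zero => exact bot_le
  | succ k ih =>
    exact degreeFiltration_succ_le (le_degreeFiltration_succ _)
      fun x n hn => apply_mem_degreeFiltration (ih hn) x

theorem degreeFiltration_mono : Monotone (degreeFiltration f W) :=
  monotone_nat_of_le_succ degreeFiltration_le_succ

theorem degreeFiltration_one : degreeFiltration f W 1 = W :=
  le_antisymm (degreeFiltration_succ_le le_rfl fun x n hn => by
    rw [(Submodule.mem_bot K).1 hn, map_zero]; exact W.zero_mem) (le_degreeFiltration_succ 0)

/-- If `W` generates `N`, the filtration is exhaustive. -/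
theorem exists_mem_degreeFiltration
    (hgen : ∀ Q : Submodule K N, W ≤ Q → (∀ x, ∀ n ∈ Q, f x n ∈ Q) → Q = ⊤) (n : N) :
    ∃ k, n ∈ degreeFiltration f W k := by
  have h := hgen (⨆ k, degreeFiltration f W k)
    ((le_degreeFiltration_succ 0).trans (le_iSup (degreeFiltration f W) 1)) (by
      intro x n hn
      obtain ⟨k, hk⟩ := (Submodule.mem_iSup_of_directed _ degreeFiltration_mono.directed_le).1 hn
      exact Submodule.mem_iSup_of_mem (k + 1) (apply_mem_degreeFiltration hk x))
  exact (Submodule.mem_iSup_of_directed _ degreeFiltration_mono.directed_le).1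
    (h ▸ Submodule.mem_top)

variable (hf : ∀ x y, f ⁅x, y⁆ = f x * f y - f y * f x)

include hf in
theorem apply_apply (x y : L) (n : N) : f x (f y n) = f y (f x n) + f ⁅x, y⁆ n := by
  rw [hf]; simp

include hf in
-- An element that preserves `W` can be moved past the other factors until it reaches `W`; each
-- commutator merges two factors into one, so the degree does not rise.
theorem apply_mem_degreeFiltration_of_stable {h : L → Prop} (hW : ∀ x, h x → ∀ n ∈ W, f x n ∈ W)
    {x : L} (hx : h x) {k : ℕ} : ∀ {n : N}, n ∈ degreeFiltration f W k →
      f x n ∈ degreeFiltration f W k := by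
  induction k with
  | zero => intro n hn; rw [(Submodule.mem_bot K).1 hn, map_zero]; exact Submodule.zero_mem _
  | succ k ih =>
    have : degreeFiltration f W (k + 1) ≤ (degreeFiltration f W (k + 1)).comap (f x) := by
      refine degreeFiltration_succ_le (fun n hn => le_degreeFiltration_succ _ (hW x hx n hn))
        fun y n hn => ?_
      rw [Submodule.mem_comap, apply_apply hf]
      exact Submodule.add_mem _ (apply_mem_degreeFiltration (ih hn) y)
        (apply_mem_degreeFiltration hn _)
    exact fun {_} hn => this hn

section Monomials

variable {ι : Type*} (e : ι → L)

variable (f) in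
/-- The operator `e_{i_1} ⋯ e_{i_k}` for a list `[i_1, …, i_k]`. -/
def monomialOp (l : List ι) : Module.End K N := (l.map fun i => f (e i)).prod

@[simp]
theorem monomialOp_nil : monomialOp f e [] = 1 := rfl

theorem monomialOp_cons (i : ι) (l : List ι) (n : N) :
    monomialOp f e (i :: l) n = f (e i) (monomialOp f e l n) := by
  simp [monomialOp]

theorem monomialOp_append (l l' : List ι) (n : N) :
    monomialOp f e (l ++ l') n = monomialOp f e l (monomialOp f e l' n) := by
  simp [monomialOp]

theorem monomialOp_mem {n : N} (hn : n ∈ W) (l : List ι) :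
    monomialOp f e l n ∈ degreeFiltration f W (l.length + 1) := by
  induction l with
  | nil => exact le_degreeFiltration_succ _ hn
  | cons i l ih => rw [monomialOp_cons]; exact apply_mem_degreeFiltration ih _

include hf in
-- A transposition costs a commutator, which has one factor fewer. Monomials of length r live in
-- level r + 1, so level `l.length` is strictly lower.
theorem monomialOp_perm {n : N} (hn : n ∈ W) {l l' : List ι} (h : l.Perm l') :
    monomialOp f e l n - monomialOp f e l' n ∈ degreeFiltration f W l.length := by
  induction h with
  | nil => simp
  | cons i _ ih =>
    rw [monomialOp_cons, monomialOp_cons, ← map_sub]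
    exact apply_mem_degreeFiltration ih _
  | swap i j l =>
    rw [monomialOp_cons, monomialOp_cons, monomialOp_cons, monomialOp_cons,
      apply_apply hf, add_sub_cancel_left]
    exact apply_mem_degreeFiltration (monomialOp_mem e hn l) _
  | trans h₁ _ ih₁ ih₂ =>
    rw [← h₁.length_eq] at ih₂
    rw [← sub_add_sub_cancel]
    exact Submodule.add_mem _ ih₁ ih₂

variable (f W) in
/-- The span of the monomials of length `k`. -/
def monomialSpan (k : ℕ) : Submodule K N :=
  Submodule.span K {n | ∃ (l : List ι) (w : N), l.length = k ∧ w ∈ W ∧ n = monomialOp f e l w}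

theorem apply_mem_monomialSpan (i : ι) {k : ℕ} {n : N} (hn : n ∈ monomialSpan f W e k) :
    f (e i) n ∈ monomialSpan f W e (k + 1) := by
  have : monomialSpan f W e k ≤ (monomialSpan f W e (k + 1)).comap (f (e i)) := by
    refine Submodule.span_le.2 ?_
    rintro _ ⟨l, w, hl, hw, rfl⟩
    exact Submodule.subset_span ⟨i :: l, w, by simp [hl], hw, by rw [monomialOp_cons]⟩
  exact this hn

variable [Fintype ι] {h : L → Prop} (hW : ∀ x, h x → ∀ n ∈ W, f x n ∈ W)
  (hL : ∀ x : L, ∃ y, h y ∧ ∃ c : ι → F, x = y + ∑ i, c i • e i)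

include hf hW hL in
-- The spanning half of a PBW statement: the component of a factor that preserves `W` does not raise
-- the degree, so only the `e i` contribute to the top degree.
theorem degreeFiltration_succ_le_sup_monomialSpan (k : ℕ) :
    degreeFiltration f W (k + 1) ≤ degreeFiltration f W k ⊔ monomialSpan f W e k := by
  induction k with
  | zero =>
    rw [zero_add, degreeFiltration_one]
    exact fun n hn => Submodule.mem_sup_right (Submodule.subset_span ⟨[], n, rfl, hn, by simp⟩)
  | succ k ih =>
    refine degreeFiltration_succ_le
      (fun n hn => Submodule.mem_sup_left (le_degreeFiltration_succ _ hn)) fun x n hn => ?_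
    obtain ⟨y, hy, c, rfl⟩ := hL x
    obtain ⟨a, ha, m, hm, rfl⟩ := Submodule.mem_sup.1 (ih hn)
    rw [map_add f, map_sum, LinearMap.add_apply, LinearMap.sum_apply]
    refine Submodule.add_mem _
      (Submodule.mem_sup_left (apply_mem_degreeFiltration_of_stable hf hW hy hn))
      (Submodule.sum_mem _ fun i _ => ?_)
    rw [map_smul, LinearMap.smul_apply, ← algebraMap_smul K (c i)]
    refine Submodule.smul_mem _ _ ?_
    rw [map_add]
    exact Submodule.add_mem _ (Submodule.mem_sup_left (apply_mem_degreeFiltration ha _))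
      (Submodule.mem_sup_right (apply_mem_monomialSpan e i hm))

include hf hW hL in
-- Replaces the supremum over all of `L` by a finite one, so that finite generation passes to each
-- level.
theorem degreeFiltration_succ_eq_sup_iSup (k : ℕ) :
    degreeFiltration f W (k + 1) =
      W ⊔ degreeFiltration f W k ⊔ ⨆ i, (degreeFiltration f W k).map (f (e i)) := by
  refine le_antisymm (degreeFiltration_succ_le (le_sup_left.trans le_sup_left) fun x n hn => ?_)
    (sup_le (sup_le (le_degreeFiltration_succ k) (degreeFiltration_le_succ k))
      (iSup_le fun i => Submodule.map_le_iff_le_comap.2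
        fun n hn => apply_mem_degreeFiltration hn _))
  obtain ⟨y, hy, c, rfl⟩ := hL x
  rw [map_add, map_sum, LinearMap.add_apply, LinearMap.sum_apply]
  refine Submodule.add_mem _ (Submodule.mem_sup_left (Submodule.mem_sup_right
    (apply_mem_degreeFiltration_of_stable hf hW hy hn))) (Submodule.sum_mem _ fun i _ => ?_)
  rw [map_smul, LinearMap.smul_apply, ← algebraMap_smul K (c i)]
  exact Submodule.smul_mem _ _ (Submodule.mem_sup_right
    (Submodule.mem_iSup_of_mem i (Submodule.mem_map_of_mem hn)))

include hf hW hL in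
theorem degreeFiltration_fg (hfg : W.FG) (k : ℕ) : (degreeFiltration f W k).FG := by
  induction k with
  | zero => exact Submodule.fg_bot
  | succ k ih =>
    rw [degreeFiltration_succ_eq_sup_iSup hf e hW hL]
    exact (hfg.sup ih).sup (Submodule.fg_iSup _ fun i => ih.map _)

variable [DecidableEq ι] {p : ℕ} (hp : 2 ≤ p) {P : L → L} {z : L → K}
  (hP : ∀ (x : L) (n : N), ((f x) ^ p) n = f (P x) n + z x • n)

omit [Fintype ι] in
include hf hp hP in
/-- A monomial in which some index occurs at least `p` times has lower degree. -/
theorem monomialOp_mem_of_le_count {n : N} (hn : n ∈ W) {l : List ι} {i : ι}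
    (hi : p ≤ l.count i) : monomialOp f e l n ∈ degreeFiltration f W l.length := by
  -- Move `p` copies of `e i` to the front; their product is one element of `L` plus a scalar, and 1
  -- < p.
  obtain ⟨l', hl'⟩ := (List.replicate_sublist_iff.2 hi).exists_perm_append
  have h1 := monomialOp_perm hf e hn hl'
  have hlen : l.length = p + l'.length := by rw [hl'.length_eq]; simp
  have h2 : monomialOp f e (List.replicate p i ++ l') n ∈ degreeFiltration f W l.length := by
    rw [monomialOp_append]
    have h3 : monomialOp f e (List.replicate p i) = (f (e i)) ^ p := by simp [monomialOp]
    rw [h3, hP]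
    have h4 := monomialOp_mem (f := f) e hn l'
    exact Submodule.add_mem _
      (degreeFiltration_mono (by omega) (apply_mem_degreeFiltration h4 _))
      (Submodule.smul_mem _ _ (degreeFiltration_mono (by omega) h4))
  rw [← sub_add_cancel (monomialOp f e l n)]
  exact Submodule.add_mem _ h1 h2

include hf hW hL hp hP in
/-- If `W` is finitely generated and generates `N` as an `L`-module, then `N` is finitely
generated. -/
theorem finite_of_generates (hfg : W.FG)
    (hgen : ∀ Q : Submodule K N, W ≤ Q → (∀ x, ∀ n ∈ Q, f x n ∈ Q) → Q = ⊤) :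
    Module.Finite K N := by
  -- By pigeonhole, a list of at least this length repeats some index `p` times, so the filtration
  -- stops growing here.
  set m := Fintype.card ι * p + 1 with hm
  have hstep : ∀ k, m ≤ k → degreeFiltration f W (k + 1) ≤ degreeFiltration f W k := by
    intro k hk
    refine (degreeFiltration_succ_le_sup_monomialSpan hf e hW hL k).trans
      (sup_le le_rfl (Submodule.span_le.2 ?_))
    rintro _ ⟨l, w, hl, hw, rfl⟩
    by_cases hc : ∃ i, p ≤ l.count i
    · obtain ⟨i, hi⟩ := hc
      rw [← hl]
      exact monomialOp_mem_of_le_count hf e hp hP hw hi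
    · push Not at hc
      have h1 : ∑ i, l.count i = l.length := by
        have := Multiset.sum_count_eq_card (s := Finset.univ) (m := (l : Multiset ι)) (by simp)
        simpa using this
      have h2 : ∑ i, l.count i ≤ ∑ _i : ι, p := Finset.sum_le_sum fun i _ => (hc i).le
      simp only [Finset.sum_const, Finset.card_univ, smul_eq_mul] at h2
      omega
  have hle : ∀ k, degreeFiltration f W k ≤ degreeFiltration f W m := by
    intro k
    induction k with
    | zero => exact bot_le
    | succ k ih =>
      by_cases hk : m ≤ k
      · exact (hstep k hk).trans ih
      · exact degreeFiltration_mono (by omega)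
  refine ⟨?_⟩
  have htop : degreeFiltration f W m = ⊤ := top_le_iff.1 fun n _ => by
    obtain ⟨k, hk⟩ := exists_mem_degreeFiltration hgen n
    exact hle k hk
  rw [← htop]
  exact degreeFiltration_fg hf e hW hL hfg m

end Monomials

end Filtration

/-! ### Eigenvectors of the ideal and Euler operators -/

section Eigenvectors

variable {F : Type*} [Field F] {L : Type*} [LieRing L] [LieAlgebra F L] {N : Type*}
  [AddCommGroup N] [Module F N] {f : L →ₗ[F] Module.End F N} {W : Submodule F N}
  {I : LieIdeal F L} {lam : Module.Dual F I}

variable (f lam) in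
/-- The operator `λ(y) - y` for `y ∈ I`. -/
def shiftedOp (y : I) : Module.End F N := lam y • 1 - f y

theorem shiftedOp_eq_zero_iff {y : I} {n : N} : shiftedOp f lam y n = 0 ↔ f y n = lam y • n := by
  simp only [shiftedOp, LinearMap.sub_apply, LinearMap.smul_apply, Module.End.one_apply,
    sub_eq_zero]
  exact eq_comm

variable (hf : ∀ x y, f ⁅x, y⁆ = f x * f y - f y * f x)
  (hWI : ∀ y : I, ∀ n ∈ W, f y n = lam y • n)

include hf in
-- Moving `y` past `x` produces ⁅x, y⁆, which is again in the ideal and so is a scalar minus a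
-- shifted operator. The scalar is the pairing that defines L^λ.
theorem shiftedOp_apply (y : I) (x : L) (n : N) :
    shiftedOp f lam y (f x n) =
      f x (shiftedOp f lam y n) - shiftedOp f lam ⁅x, y⁆ n + lam ⁅x, y⁆ • n := by
  simp only [shiftedOp, LinearMap.sub_apply, LinearMap.smul_apply, Module.End.one_apply, map_sub,
    map_smul]
  have h : f ((⁅x, y⁆ : I) : L) n = f x (f y n) - f y (f x n) := by
    change f ⁅x, (y : L)⁆ n = _
    rw [hf]; simp
  rw [h]; abel

include hf hWI in
theorem shiftedOp_mem_degreeFiltration {k : ℕ} : ∀ (y : I) {n : N},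
    n ∈ degreeFiltration f W (k + 1) → shiftedOp f lam y n ∈ degreeFiltration f W k := by
  induction k with
  | zero =>
    intro y n hn
    rw [zero_add, degreeFiltration_one] at hn
    rw [shiftedOp_eq_zero_iff.2 (hWI y n hn)]
    exact Submodule.zero_mem _
  | succ k ih =>
    intro y n hn
    have : degreeFiltration f W (k + 1 + 1) ≤
        (degreeFiltration f W (k + 1)).comap (shiftedOp f lam y) := by
      refine degreeFiltration_succ_le (fun n hn => ?_) fun x n hn => ?_
      · rw [Submodule.mem_comap, shiftedOp_eq_zero_iff.2 (hWI y n hn)]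
        exact Submodule.zero_mem _
      · rw [Submodule.mem_comap, shiftedOp_apply hf]
        exact Submodule.add_mem _ (Submodule.sub_mem _ (apply_mem_degreeFiltration (ih y hn) x)
          (degreeFiltration_le_succ k (ih _ hn))) (Submodule.smul_mem _ _ hn)
    exact this hn

include hf hWI in
-- Take a nonzero vector of `Q` of least degree: the shifted operators preserve `Q` and lower the
-- degree, so they kill it.
theorem exists_shiftedOp_eq_zero
    (hgen : ∀ Q : Submodule F N, W ≤ Q → (∀ x, ∀ n ∈ Q, f x n ∈ Q) → Q = ⊤)
    {Q : Submodule F N} (hQ : ∀ y : I, ∀ n ∈ Q, f y n ∈ Q) (hne : Q ≠ ⊥) :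
    ∃ n ∈ Q, n ≠ 0 ∧ ∀ y : I, shiftedOp f lam y n = 0 := by
  classical
  have hex : ∃ k, ∃ n ∈ Q, n ≠ 0 ∧ n ∈ degreeFiltration f W k := by
    obtain ⟨n, hn, hn0⟩ := Q.ne_bot_iff.1 hne
    obtain ⟨k, hk⟩ := exists_mem_degreeFiltration hgen n
    exact ⟨k, n, hn, hn0, hk⟩
  obtain ⟨n, hn, hn0, hk⟩ := Nat.find_spec hex
  refine ⟨n, hn, hn0, fun y => ?_⟩
  by_contra hy
  rcases hk' : Nat.find hex with _ | k
  · rw [hk'] at hk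
    exact hn0 ((Submodule.mem_bot F).1 hk)
  · rw [hk'] at hk
    refine Nat.find_min hex (m := k) (by omega) ⟨shiftedOp f lam y n, ?_, hy,
      shiftedOp_mem_degreeFiltration hf hWI y hk⟩
    exact Q.sub_mem (Q.smul_mem _ hn) (hQ y n hn)

section Euler

variable {ι : Type*} (e : ι → L) (y : ι → I)

variable (f lam) in
/-- The operator `e_i (λ(y_i) - y_i)`, which acts on monomials as `e_i ∂/∂e_i` up to lower terms. -/
def eulerOp (i : ι) : Module.End F N := f (e i) * shiftedOp f lam (y i)

include hf hWI in
theorem eulerOp_mem (i : ι) {k : ℕ} {n : N} (hn : n ∈ degreeFiltration f W k) :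
    eulerOp f lam e y i n ∈ degreeFiltration f W k := by
  cases k with
  | zero => rw [(Submodule.mem_bot F).1 hn, map_zero]; exact Submodule.zero_mem _
  | succ k =>
    exact apply_mem_degreeFiltration (shiftedOp_mem_degreeFiltration hf hWI (y i) hn) _

variable [DecidableEq ι] (hey : ∀ i j, lam ⁅e j, y i⁆ = if i = j then 1 else 0)

include hf hWI hey in
-- By duality of the two families, λ(y_i) - y_i differentiates with respect to `e i` up to lower
-- degree, and `e i` restores the lost factor. All commutator corrections drop one degree.
theorem eulerOp_monomialOp (i : ι) (l : List ι) {n : N} (hn : n ∈ W) :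
    eulerOp f lam e y i (monomialOp f e l n) - (l.count i : F) • monomialOp f e l n ∈
      degreeFiltration f W l.length := by
  induction l with
  | nil =>
    simp [eulerOp, shiftedOp_eq_zero_iff.2 (hWI (y i) n hn)]
  | cons j l ih =>
    rw [monomialOp_cons]
    set m := monomialOp f e l n with hm
    have hmem : m ∈ degreeFiltration f W (l.length + 1) := monomialOp_mem e hn l
    have hT := shiftedOp_mem_degreeFiltration hf hWI (y i) hmem
    have hT' := shiftedOp_mem_degreeFiltration hf hWI ⁅e j, y i⁆ hmem
    have hcount : lam ⁅e j, y i⁆ • f (e i) m = (if j = i then (1 : F) else 0) • f (e j) m := by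
      rw [hey]
      by_cases h : i = j
      · subst h; simp
      · rw [if_neg h, if_neg (Ne.symm h), zero_smul, zero_smul]
    have hc : ((List.count i (j :: l) : ℕ) : F) =
        (l.count i : F) + (if j = i then (1 : F) else 0) := by
      rw [List.count_cons]
      simp
    have : eulerOp f lam e y i (f (e j) m) - ((List.count i (j :: l) : ℕ) : F) • f (e j) m =
        f (e j) (eulerOp f lam e y i m - (l.count i : F) • m) +
          f ⁅e i, e j⁆ (shiftedOp f lam (y i) m) - f (e i) (shiftedOp f lam ⁅e j, y i⁆ m) := by
      rw [hc, add_smul, ← hcount, eulerOp, Module.End.mul_apply, Module.End.mul_apply,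
        shiftedOp_apply hf, map_add, map_sub, map_smul, map_sub, map_smul,
        apply_apply hf (e i) (e j)]
      abel
    rw [this, List.length_cons]
    exact Submodule.sub_mem _ (Submodule.add_mem _ (apply_mem_degreeFiltration ih _)
      (apply_mem_degreeFiltration hT _)) (apply_mem_degreeFiltration hT' _)

variable [Fintype ι] {h : L → Prop} (hW : ∀ x, h x → ∀ n ∈ W, f x n ∈ W)
  (hL : ∀ x : L, ∃ z, h z ∧ ∃ c : ι → F, x = z + ∑ i, c i • e i)
  {p : ℕ} [Fact p.Prime] [CharP F p] {P : L → L} {z : L → F}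
  (hP : ∀ (x : L) (n : N), ((f x) ^ p) n = f (P x) n + z x • n)

include hf hWI hey hW hL hP in
-- Modulo level `k + 1`, the top monomials are joint eigenvectors of the Euler operators, with their
-- multiplicities as eigenvalues. A polynomial in these operators fixes the class of `n` and kills
-- every such monomial.
theorem mem_degreeFiltration_of_eulerOp_mem {k : ℕ} {n : N}
    (hn : n ∈ degreeFiltration f W (k + 2))
    (hE : ∀ i, eulerOp f lam e y i n ∈ degreeFiltration f W (k + 1)) :
    n ∈ degreeFiltration f W (k + 1) := by
  have hp : p.Prime := Fact.out
  have hp1 : p - 1 ≠ 0 := by have := hp.two_le; omega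
  set D := degreeFiltration f W (k + 1) with hD
  let Ebar : ι → Module.End F (N ⧸ D) := fun i =>
    D.mapQ D (eulerOp f lam e y i) fun n hn => eulerOp_mem hf hWI e y i hn
  have hEbar : ∀ i n, Ebar i (D.mkQ n) = D.mkQ (eulerOp f lam e y i n) := fun i n => rfl
  have heig : ∀ (A : Module.End F (N ⧸ D)) (c : F) (v : N ⧸ D), A v = c • v →
      ∀ r : ℕ, (A ^ r) v = c ^ r • v := by
    intro A c v hA r
    induction r with
    | zero => simp
    | succ r ih => rw [pow_succ', Module.End.mul_apply, ih, map_smul, hA, smul_smul, pow_succ]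
  -- By Fermat, 1 - c^(p-1) is 1 at c = 0 and 0 at the other elements of the prime field.
  let A : List ι → Module.End F (N ⧸ D) := fun s => (s.map fun i => 1 - Ebar i ^ (p - 1)).prod
  have hA_cons : ∀ i s v, A (i :: s) v = (1 - Ebar i ^ (p - 1)) (A s v) := fun i s v => by
    simp [A]
  have hA_fix : ∀ s, A s (D.mkQ n) = D.mkQ n := by
    intro s
    induction s with
    | nil => rfl
    | cons i s ih =>
      have h0 : Ebar i (D.mkQ n) = (0 : F) • D.mkQ n := by
        rw [hEbar, zero_smul]
        exact (Submodule.Quotient.mk_eq_zero D).2 (hE i)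
      rw [hA_cons, ih, LinearMap.sub_apply, heig _ _ _ h0, zero_pow hp1, zero_smul, sub_zero]
      rfl
  have hA_mono : ∀ (l : List ι) (w : N), w ∈ W → l.length = k + 1 → ∀ s : List ι,
      (∃ c : F, A s (D.mkQ (monomialOp f e l w)) = c • D.mkQ (monomialOp f e l w)) ∧
      ((∃ i ∈ s, ((l.count i : ℕ) : F) ≠ 0) → A s (D.mkQ (monomialOp f e l w)) = 0) := by
    intro l w hw hl s
    have hev : ∀ i, Ebar i (D.mkQ (monomialOp f e l w)) =
        (l.count i : F) • D.mkQ (monomialOp f e l w) := by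
      intro i
      rw [hEbar, ← map_smul, ← sub_eq_zero, ← map_sub]
      refine (Submodule.Quotient.mk_eq_zero D).2 ?_
      rw [hD, ← hl]
      exact eulerOp_monomialOp hf hWI e y hey i l hw
    have hfermat : ∀ c : ℕ, (c : F) ≠ 0 → (c : F) ^ (p - 1) = 1 := by
      intro c hc
      have h1 : (c : ZMod p) ≠ 0 := by
        intro h0
        apply hc
        rw [CharP.cast_eq_zero_iff F p]
        exact (ZMod.natCast_eq_zero_iff c p).1 h0
      have h2 := congrArg (ZMod.castHom (dvd_refl p) F) (ZMod.pow_card_sub_one_eq_one h1)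
      simpa using h2
    induction s with
    | nil => exact ⟨⟨1, by simp [A]⟩, fun ⟨i, hi, _⟩ => absurd hi List.not_mem_nil⟩
    | cons i s ih =>
      obtain ⟨⟨c, hc⟩, h0⟩ := ih
      have hstep : A (i :: s) (D.mkQ (monomialOp f e l w)) =
          (c * (1 - (l.count i : F) ^ (p - 1))) • D.mkQ (monomialOp f e l w) := by
        rw [hA_cons, hc, map_smul, LinearMap.sub_apply, heig _ _ _ (hev i), Module.End.one_apply,
          mul_smul, sub_smul, one_smul]
      refine ⟨⟨_, hstep⟩, ?_⟩
      rintro ⟨j, hj, hj0⟩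
      rcases List.mem_cons.1 hj with rfl | hj
      · rw [hstep, hfermat _ hj0, sub_self, mul_zero, zero_smul]
      · rw [hA_cons, h0 ⟨j, hj, hj0⟩, map_zero]
  have hkill : monomialSpan f W e (k + 1) ≤
      (LinearMap.ker (A Finset.univ.toList)).comap D.mkQ := by
    refine Submodule.span_le.2 ?_
    rintro _ ⟨l, w, hl, hw, rfl⟩
    change A _ (D.mkQ _) = 0
    by_cases hc : ∃ i, p ≤ l.count i
    · obtain ⟨i, hi⟩ := hc
      have : D.mkQ (monomialOp f e l w) = 0 := by
        refine (Submodule.Quotient.mk_eq_zero D).2 ?_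
        rw [hD, ← hl]
        exact monomialOp_mem_of_le_count hf e hp.two_le hP hw hi
      rw [this, map_zero]
    · push Not at hc
      -- The length `k + 1` is positive, so some multiplicity lies between 1 and `p - 1` and is
      -- nonzero in `F`.
      obtain ⟨i, hi⟩ : ∃ i, i ∈ l := List.exists_mem_of_length_pos (by omega)
      refine (hA_mono l w hw hl _).2 ⟨i, by simp, fun h0 => ?_⟩
      rw [CharP.cast_eq_zero_iff F p] at h0
      have := Nat.le_of_dvd (List.count_pos_iff.2 hi) h0
      exact absurd (hc i) (by omega)
  obtain ⟨a, ha, m, hm, rfl⟩ :=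
    Submodule.mem_sup.1 (degreeFiltration_succ_le_sup_monomialSpan hf e hW hL (k + 1) hn)
  have h1 := hA_fix Finset.univ.toList
  have ha0 : D.mkQ a = 0 := (Submodule.Quotient.mk_eq_zero D).2 ha
  have hm0 : A Finset.univ.toList (D.mkQ m) = 0 := hkill hm
  rw [map_add, ha0, zero_add, hm0] at h1
  exact D.add_mem ha ((Submodule.Quotient.mk_eq_zero D).1 h1.symm)

include hf hWI hey hW hL hP in
/-- If `W` generates `N` and `I` acts on `W` through `λ`, then `N^λ = W`. -/
theorem mem_of_shiftedOp_eq_zero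
    (hgen : ∀ Q : Submodule F N, W ≤ Q → (∀ x, ∀ n ∈ Q, f x n ∈ Q) → Q = ⊤) {n : N}
    (hn : ∀ a : I, shiftedOp f lam a n = 0) : n ∈ W := by
  obtain ⟨k, hk⟩ := exists_mem_degreeFiltration hgen n
  have : ∀ k, n ∈ degreeFiltration f W (k + 1) → n ∈ degreeFiltration f W 1 := by
    intro k
    induction k with
    | zero => exact id
    | succ k ih =>
      intro h'
      refine ih (mem_degreeFiltration_of_eulerOp_mem hf hWI e y hey hW hL hP h' fun i => ?_)
      rw [eulerOp, Module.End.mul_apply, hn, map_zero]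
      exact Submodule.zero_mem _
  rw [← degreeFiltration_one (f := f) (W := W)]
  exact this k (degreeFiltration_le_succ k hk)

end Euler

end Eigenvectors

/-! ### A complement of the stabilizer and its dual family -/

section DualFamilies

theorem exists_eval_extension {F V : Type*} [Field F] [AddCommGroup V] [Module F V]
    [Module.Finite F V] (R : Submodule F (Module.Dual F V)) (g : Module.Dual F R) :
    ∃ x : V, ∀ r : R, (r : Module.Dual F V) x = g r := by
  obtain ⟨g', hg'⟩ := LinearMap.exists_extend g
  obtain ⟨x, rfl⟩ := (Module.evalEquiv F V).surjective g'
  exact ⟨x, fun r => LinearMap.congr_fun hg' r⟩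

variable {F : Type*} [Field F] {L : Type*} [LieRing L] [LieAlgebra F L] [Module.Finite F L]
  {I : LieIdeal F L}

/-- A complement of `L^λ` with a dual family in `I` for the form `(x, y) ↦ λ([x, y])`. -/
theorem exists_dual_families (lam : Module.Dual F I) :
    ∃ (m : ℕ) (e : Fin m → L) (y : Fin m → I),
      (∀ i j, lam ⁅e j, y i⁆ = if i = j then 1 else 0) ∧
      ∀ x : L, ∃ z, z ∈ stabilizer lam ∧ ∃ c : Fin m → F, x = z + ∑ i, c i • e i := by
  let B : I →ₗ[F] Module.Dual F L :=
    { toFun := fun y =>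
        { toFun := fun x => lam ⁅x, y⁆
          map_add' := fun a b => by rw [add_lie, map_add]
          map_smul' := fun c a => by rw [smul_lie, map_smul]; rfl }
      map_add' := fun a b => by ext x; simp
      map_smul' := fun c a => by ext x; simp }
  have hB : ∀ y x, B y x = lam ⁅x, y⁆ := fun _ _ => rfl
  -- L^λ is the common kernel of the forms in `R`. A basis of `R` lifts to the `y i`, and its dual
  -- basis is realised by evaluation at the `e j`.
  let R : Submodule F (Module.Dual F L) := LinearMap.range B
  have : Module.Free F R := Module.Free.of_divisionRing F R
  let b := Module.finBasis F R
  have hy : ∀ i, ∃ y, B y = b i := fun i => (b i).2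
  choose y hy using hy
  have he : ∀ j, ∃ x : L, ∀ r : R, (r : Module.Dual F L) x = b.coord j r := fun j =>
    exists_eval_extension R (b.coord j)
  choose e he using he
  have hey : ∀ i j, B (y i) (e j) = if i = j then 1 else 0 := by
    intro i j
    rw [hy, he, Module.Basis.coord_apply, Module.Basis.repr_self, Finsupp.single_apply]
  refine ⟨_, e, y, fun i j => by rw [← hB, hey], fun x => ?_⟩
  refine ⟨x - ∑ i, B (y i) x • e i, ?_, fun i => B (y i) x, by simp⟩
  intro a
  rw [← hB]
  have hspan : (⟨B a, a, rfl⟩ : R) ∈ Submodule.span F (Set.range b) := by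
    rw [b.span_eq]; trivial
  have key : ∀ r : R, (r : Module.Dual F L) (x - ∑ i, B (y i) x • e i) = 0 := by
    intro r
    rw [← b.sum_repr r]
    simp only [Submodule.coe_sum, Submodule.coe_smul, LinearMap.sum_apply, LinearMap.smul_apply]
    refine Finset.sum_eq_zero fun j _ => ?_
    rw [← hy, map_sub, map_sum]
    simp [hey]
  exact key ⟨B a, a, rfl⟩

end DualFamilies

/-! ### Reduced enveloping algebras and induced modules -/

section Induced

variable {F : Type u} [Field F] {p : ℕ} {L : Type v} [LieRing L] [LieAlgebra F L]

/-- The map U(L) → Z given by the universal property, followed by the inclusion of `Z`, is the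
quotient map, which is onto. Identities on u(L, S) can thus be checked on `L`. -/
theorem ReducedEnveloping.subalgebra_eq_top (P : PMapping F p L) (S : Module.Dual F L)
    (Z : Subalgebra F (ReducedEnveloping P S)) (hZ : ∀ x, ReducedEnveloping.ι P S x ∈ Z) :
    Z = ⊤ := by
  let g : L →ₗ⁅F⁆ Z :=
    { toFun := fun x => ⟨ReducedEnveloping.ι P S x, hZ x⟩
      map_add' := fun a b => Subtype.ext (map_add _ a b)
      map_smul' := fun c a => Subtype.ext (map_smul (ReducedEnveloping.ι P S) c a)
      map_lie' := fun {a b} => Subtype.ext (LieHom.map_lie (ReducedEnveloping.ι P S) a b) }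
  have h : Z.val.comp (UniversalEnvelopingAlgebra.lift F g) =
      RingQuot.mkAlgHom F (ReducedRel P S) := by
    apply UniversalEnvelopingAlgebra.hom_ext
    ext x
    change Z.val (UniversalEnvelopingAlgebra.lift F g (UniversalEnvelopingAlgebra.ι F x)) =
      ReducedEnveloping.ι P S x
    rw [UniversalEnvelopingAlgebra.lift_ι_apply]
    rfl
  refine top_le_iff.1 fun a _ => ?_
  obtain ⟨b, rfl⟩ := RingQuot.mkAlgHom_surjective F (ReducedRel P S) a
  rw [← h]
  exact (UniversalEnvelopingAlgebra.lift F g b).2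

theorem toEnd_lie (V : Type w) [AddCommGroup V] [Module F V] [LieRingModule L V]
    [LieModule F L V] (x y : L) :
    (LieModule.toEnd F L V : L →ₗ[F] Module.End F V) ⁅x, y⁆ =
      (LieModule.toEnd F L V : L →ₗ[F] Module.End F V) x *
        (LieModule.toEnd F L V : L →ₗ[F] Module.End F V) y -
      (LieModule.toEnd F L V : L →ₗ[F] Module.End F V) y *
        (LieModule.toEnd F L V : L →ₗ[F] Module.End F V) x :=
  LieHom.map_lie (LieModule.toEnd F L V) x y

theorem IsSRepresentation.pow_apply {P : PMapping F p L} {S : Module.Dual F L} {V : Type w}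
    [AddCommGroup V] [Module F V] [LieRingModule L V] [LieModule F L V]
    (hV : IsSRepresentation P S V) (x : L) (n : V) :
    ((LieModule.toEnd F L V : L →ₗ[F] Module.End F V) x ^ p) n =
      (LieModule.toEnd F L V : L →ₗ[F] Module.End F V) (P.toFun x) n + (S x) ^ p • n := by
  have h := LinearMap.congr_fun (hV x) n
  exact eq_add_of_sub_eq' h

section Ind

variable (P : PMapping F p L) (S : Module.Dual F L) (H : LieSubalgebra F L)
  (hH : IsPSubalgebra P H) (M : Type w) [AddCommGroup M] [Module F M] [LieRingModule H M]
  [LieModule F H M] (hM : IsSRepresentation (P.restrict H hH) (restrictForm S H) M)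

theorem ReducedEnveloping.incl_ι (x : H) :
    ReducedEnveloping.incl P S H hH (ReducedEnveloping.ι _ _ x) = ReducedEnveloping.ι P S (x : L) :=
  ReducedEnveloping.lift_ι _ _ _ _ _

omit hM in
theorem ReducedEnveloping.act_ι {V : Type*} [AddCommGroup V] [Module F V] [LieRingModule L V]
    [LieModule F L V] (hV : IsSRepresentation P S V) (x : L) (v : V) :
    ReducedEnveloping.act P S V hV (ReducedEnveloping.ι P S x) v = ⁅x, v⁆ := by
  rw [ReducedEnveloping.act, ReducedEnveloping.lift_ι]
  rfl

namespace Ind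

/-- The canonical map `m ↦ 1 ⊗ m`. -/
def of : M →ₗ[F] Ind P S H hH M hM where
  toFun m := Submodule.Quotient.mk (1 ⊗ₜ[F] m)
  map_add' a b := by rw [TensorProduct.tmul_add]; rfl
  map_smul' c a := by rw [TensorProduct.tmul_smul]; rfl

theorem lie_of (x : H) (m : M) :
    ⁅(x : L), of P S H hH M hM m⁆ = of P S H hH M hM ⁅x, m⁆ := by
  refine (Submodule.Quotient.eq _).2 ?_
  refine Submodule.subset_span ⟨1, ReducedEnveloping.ι _ _ x, m, ?_⟩
  rw [ReducedEnveloping.incl_ι, ReducedEnveloping.act_ι, one_mul]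
  change (ReducedEnveloping.ι P S (x : L) * 1) ⊗ₜ[F] m - _ = _
  rw [mul_one]

theorem isSRepresentation : IsSRepresentation P S (Ind P S H hH M hM) := by
  intro x
  have key : ∀ (n : ℕ) (v : Ind P S H hH M hM),
      ((LieModule.toEnd F L (Ind P S H hH M hM) x) ^ n) v = (ReducedEnveloping.ι P S x) ^ n • v := by
    intro n v
    induction n with
    | zero => simp
    | succ n ih => rw [pow_succ', pow_succ', Module.End.mul_apply, ih, mul_smul]; rfl
  ext v
  rw [LinearMap.sub_apply, key]
  change _ - ReducedEnveloping.ι P S (P.toFun x) • v = (S x) ^ p • v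
  rw [← sub_smul, ReducedEnveloping.ι_pow_sub, algebraMap_smul]

/-- The elements of u(L, S) that preserve `Q` form a subalgebra containing `L`, hence everything,
and each a ⊗ m is a · (1 ⊗ m). -/
theorem eq_top_of_range_of_le {Q : Submodule F (Ind P S H hH M hM)}
    (hQ : LinearMap.range (of P S H hH M hM) ≤ Q) (hL : ∀ x : L, ∀ n ∈ Q, ⁅x, n⁆ ∈ Q) :
    Q = ⊤ := by
  let Z : Subalgebra F (ReducedEnveloping P S) :=
    { carrier := {a | ∀ n ∈ Q, a • n ∈ Q}
      mul_mem' := fun {a b} ha hb n hn => by rw [mul_smul]; exact ha _ (hb n hn)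
      add_mem' := fun {a b} ha hb n hn => by rw [add_smul]; exact Q.add_mem (ha n hn) (hb n hn)
      algebraMap_mem' := fun c n hn => by rw [algebraMap_smul]; exact Q.smul_mem c hn }
  have hZ : Z = ⊤ := ReducedEnveloping.subalgebra_eq_top P S Z fun x n hn => hL x n hn
  have hmem : ∀ (a : ReducedEnveloping P S), ∀ n ∈ Q, a • n ∈ Q := fun a => by
    have : a ∈ Z := hZ ▸ Algebra.mem_top
    exact this
  refine top_le_iff.1 fun n _ => ?_
  obtain ⟨t, rfl⟩ := Submodule.Quotient.mk_surjective (balancedRelations P S H hH M hM) n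
  induction t with
  | zero => exact Q.zero_mem
  | add s t hs ht => exact Q.add_mem (hs trivial) (ht trivial)
  | tmul a m =>
    have h := hmem a _ (hQ ⟨m, rfl⟩)
    have e : a • of P S H hH M hM m =
        Submodule.Quotient.mk (p := balancedRelations P S H hH M hM) (a ⊗ₜ[F] m) := by
      change a • Submodule.Quotient.mk (p := balancedRelations P S H hH M hM) (1 ⊗ₜ[F] m) = _
      rw [← Submodule.Quotient.mk_smul, TensorProduct.smul_tmul', smul_eq_mul, mul_one]
    rwa [e] at h

/-- Frobenius reciprocity: an `H`-linear map from `M` to an `L`-module with character `S` extends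
to the induced module. -/
theorem exists_extension {V : Type*} [AddCommGroup V] [Module F V] [LieRingModule L V]
    [LieModule F L V] (hV : IsSRepresentation P S V) (g : M →ₗ[F] V)
    (hg : ∀ (x : H) (m : M), g ⁅x, m⁆ = ⁅(x : L), g m⁆) :
    ∃ φ : Ind P S H hH M hM →ₗ⁅F,L⁆ V, ∀ m, φ (of P S H hH M hM m) = g m := by
  let _ : Module (ReducedEnveloping P S) V :=
    Module.compHom V (ReducedEnveloping.act P S V hV).toRingHom
  have hsmul : ∀ (a : ReducedEnveloping P S) (v : V),
      a • v = ReducedEnveloping.act P S V hV a v := fun _ _ => rfl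
  have hι : ∀ (x : L) (v : V), ReducedEnveloping.ι P S x • v = ⁅x, v⁆ := by
    intro x v
    rw [hsmul, ReducedEnveloping.act_ι]
  have : IsScalarTower F (ReducedEnveloping P S) V := ⟨fun c a v => by
    rw [hsmul, hsmul, map_smul]; rfl⟩
  have : SMulCommClass F (ReducedEnveloping P S) V := ⟨fun c a v => by
    rw [hsmul, hsmul, map_smul]⟩
  have : SMulCommClass (ReducedEnveloping P S) F V := ⟨fun c a v => by
    rw [hsmul, hsmul, map_smul]⟩
  have hincl : ∀ (h : ReducedEnveloping (P.restrict H hH) (restrictForm S H)) (m : M),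
      ReducedEnveloping.incl P S H hH h • g m =
        g (ReducedEnveloping.act (P.restrict H hH) (restrictForm S H) M hM h m) := by
    let Z : Subalgebra F (ReducedEnveloping (P.restrict H hH) (restrictForm S H)) :=
      { carrier := {h | ∀ m, ReducedEnveloping.incl P S H hH h • g m =
          g (ReducedEnveloping.act (P.restrict H hH) (restrictForm S H) M hM h m)}
        mul_mem' := fun {a b} ha hb m => by
          rw [map_mul, mul_smul, hb, ha, map_mul, Module.End.mul_apply]
        add_mem' := fun {a b} ha hb m => by
          rw [map_add, add_smul, hb, ha, map_add, LinearMap.add_apply, map_add]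
        algebraMap_mem' := fun c m => by
          rw [AlgHom.commutes, AlgHom.commutes, algebraMap_smul, Module.algebraMap_end_apply,
            map_smul] }
    have hZ : Z = ⊤ := ReducedEnveloping.subalgebra_eq_top _ _ Z fun x m => by
      rw [ReducedEnveloping.incl_ι, ReducedEnveloping.act_ι]
      exact (hι x (g m)).trans (hg x m).symm
    intro h
    have : h ∈ Z := hZ ▸ Algebra.mem_top
    exact this
  let t : ReducedEnveloping P S ⊗[F] M →ₗ[ReducedEnveloping P S] V :=
    TensorProduct.AlgebraTensorModule.lift
      { toFun := fun a =>
          { toFun := fun m => a • g m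
            map_add' := fun m n => by rw [map_add, smul_add]
            map_smul' := fun c m => by rw [map_smul, RingHom.id_apply, smul_comm] }
        map_add' := fun a b => by ext m; exact add_smul a b (g m)
        map_smul' := fun a b => by ext m; exact mul_smul a b (g m) }
  have ht : ∀ a m, t (a ⊗ₜ[F] m) = a • g m := fun _ _ => rfl
  have hker : balancedRelations P S H hH M hM ≤ LinearMap.ker t := by
    refine Submodule.span_le.2 ?_
    rintro _ ⟨a, h, m, rfl⟩
    change t _ = 0
    rw [map_sub, ht, ht, mul_smul, hincl, sub_self]
  let φ : Ind P S H hH M hM →ₗ[ReducedEnveloping P S] V :=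
    (balancedRelations P S H hH M hM).liftQ t hker
  refine ⟨{ toFun := φ, map_add' := map_add φ, map_smul' := fun c n => ?_,
            map_lie' := fun {x n} => ?_ }, fun m => ?_⟩
  · rw [RingHom.id_apply, ← algebraMap_smul (ReducedEnveloping P S) c n, map_smul,
      algebraMap_smul]
  · exact (map_smul φ _ n).trans (hι x (φ n))
  · change t (1 ⊗ₜ[F] m) = g m
    rw [ht, one_smul]

end Ind

end Ind

/-! ### Irreducibility of V^λ and the isomorphism with the induced module -/

section Irreducible

/-- Here λ(I^{(1)}) = 0 enters: `I` lies in the inducing subalgebra, so it acts on 1 ⊗ V^λ through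
λ. -/
theorem coe_mem_stabilizer {I : LieIdeal F L} {lam : Module.Dual F I} (hlam : VanishesOnDerived lam) (y : I) :
    (y : L) ∈ stabilizer lam := by
  intro y'
  refine hlam _ ?_
  have h : ⁅(y : L), y'⁆ = ⁅y, y'⁆ := rfl
  rw [h, LieAlgebra.derivedSeries_def, LieAlgebra.derivedSeriesOfIdeal_succ,
    LieAlgebra.derivedSeriesOfIdeal_zero]
  exact LieSubmodule.lie_mem_lie (LieSubmodule.mem_top y) (LieSubmodule.mem_top y')

omit [LieAlgebra F L] in
theorem eq_top_of_isIrreducible {V : Type w} [AddCommGroup V] [Module F V] [LieRingModule L V]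
    (hV : LieModule.IsIrreducible F L V) {W : Submodule F V}
    (hW : W ≠ ⊥) (Q : Submodule F V) (hQ : W ≤ Q) (hL : ∀ x : L, ∀ n ∈ Q, ⁅x, n⁆ ∈ Q) :
    Q = ⊤ := by
  let Q' : LieSubmodule F L V := { Q with lie_mem := fun {x n} hn => hL x n hn }
  have h : Q' ≠ ⊥ := by
    intro h
    apply hW
    rw [eq_bot_iff]
    refine hQ.trans ?_
    have : (Q' : Submodule F V) = ⊥ := by rw [h]; rfl
    exact this.le
  have : (Q' : Submodule F V) = ⊤ := by
    rw [(hV.eq_bot_or_eq_top Q').resolve_left h]; rfl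
  exact this

variable [Module.Finite F L] [Fact p.Prime] [CharP F p] {I : LieIdeal F L}
  {lam : Module.Dual F I} {V : Type w} [AddCommGroup V] [Module F V] [LieRingModule L V]
  [LieModule F L V]

/-- If `V` is irreducible with character `S` and `V^λ ≠ 0`, then `V^λ` is irreducible. -/
theorem isIrreducible_eigenspace {P : PMapping F p L} {S : Module.Dual F L}
    (hV : LieModule.IsIrreducible F L V) (hS : IsSRepresentation P S V)
    (hne : eigenspace lam V ≠ ⊥) :
    LieModule.IsIrreducible F (stabilizer lam) (eigenspace lam V) := by
  have : Nontrivial (eigenspace lam V) := (LieSubmodule.nontrivial_iff_ne_bot F _ V).2 hne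
  refine LieModule.IsIrreducible.mk fun W hW => ?_
  obtain ⟨m, e, y, hey, hL⟩ := exists_dual_families lam
  let W' : Submodule F V := (W : Submodule F (eigenspace lam V)).map
    ((eigenspace lam V : Submodule F V).subtype)
  have hW' : W' ≠ ⊥ := by
    intro h
    apply hW
    rw [LieSubmodule.eq_bot_iff]
    intro w hw
    have : (w : V) ∈ W' := ⟨w, hw, rfl⟩
    rw [h, Submodule.mem_bot] at this
    exact Subtype.ext this
  refine eq_top_iff.2 fun v _ => ?_
  -- `W'` generates `V` by irreducibility, so it contains all λ-eigenvectors.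
  have key := mem_of_shiftedOp_eq_zero (f := (LieModule.toEnd F L V : L →ₗ[F] Module.End F V))
    (W := W') (lam := lam) (toEnd_lie V)
    (fun a n hn => by obtain ⟨w, _, rfl⟩ := hn; exact w.2 a) e y hey
    (h := fun x => x ∈ stabilizer lam)
    (fun x hx n hn => by
      have h : ∀ w ∈ W, ⁅x, (w : V)⁆ ∈ W' := fun w hw =>
        ⟨(⁅(⟨x, hx⟩ : stabilizer lam), w⁆ : eigenspace lam V), W.lie_mem hw, rfl⟩
      obtain ⟨w, hw, rfl⟩ := hn
      exact h w hw)
    hL hS.pow_apply (eq_top_of_isIrreducible hV hW') (n := (v : V))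
    (fun a => shiftedOp_eq_zero_iff.2 (v.2 a))
  obtain ⟨w, hw, hwv⟩ := key
  rwa [← Subtype.ext hwv]

/-- If `V` is irreducible with character `S` and `V^λ ≠ 0`, then `V` is induced from `V^λ`. -/
theorem nonempty_equiv_indEigenspace {P : PMapping F p L} {S : Module.Dual F L}
    (hV : LieModule.IsIrreducible F L V) (hS : IsSRepresentation P S V)
    (hlam : VanishesOnDerived lam) (hne : eigenspace lam V ≠ ⊥) :
    Nonempty (V ≃ₗ⁅F,L⁆ IndEigenspace P S lam V hS) := by
  obtain ⟨m, e, y, hey, hL⟩ := exists_dual_families lam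
  have hH := stabilizer_isPSubalgebra P lam
  have hM := eigenspace_isSRepresentation P S lam V hS
  let j := Ind.of P S (stabilizer lam) hH (eigenspace lam V) hM
  obtain ⟨φ, hφ⟩ := Ind.exists_extension P S (stabilizer lam) hH (eigenspace lam V) hM hS
    ((eigenspace lam V : Submodule F V).subtype) fun _ _ => rfl
  have hφ' : ∀ w, φ (j w) = (w : V) := hφ
  have hlie : ∀ (x : stabilizer lam) w, ⁅(x : L), j w⁆ = j ⁅x, w⁆ := Ind.lie_of P S _ hH _ hM
  have hI : ∀ (a : I) (w : eigenspace lam V), ⁅(a : L), j w⁆ = lam a • j w := by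
    intro a w
    have h1 : ⁅(⟨a, coe_mem_stabilizer hlam a⟩ : stabilizer lam), w⁆ = lam a • w :=
      Subtype.ext (w.2 a)
    have h2 := hlie ⟨a, coe_mem_stabilizer hlam a⟩ w
    rw [h1, map_smul] at h2
    exact h2
  have hgen := fun Q hQ h => Ind.eq_top_of_range_of_le P S (stabilizer lam) hH
    (eigenspace lam V) hM (Q := Q) hQ h
  have hWI : ∀ a : I, ∀ n ∈ LinearMap.range j,
      (LieModule.toEnd F L (IndEigenspace P S lam V hS) : L →ₗ[F] Module.End F _) a n =
        lam a • n := by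
    rintro a _ ⟨w, rfl⟩
    exact hI a w
  -- A nonzero kernel would contain a λ-eigenvector of `I`; that vector lies in the range of `j`,
  -- where `φ` is the inclusion of V^λ.
  have hinj : LinearMap.ker (φ : IndEigenspace P S lam V hS →ₗ[F] V) = ⊥ := by
    by_contra hker
    obtain ⟨n, hn, hn0, hnI⟩ := exists_shiftedOp_eq_zero (W := LinearMap.range j) (lam := lam)
      (toEnd_lie (IndEigenspace P S lam V hS)) hWI hgen
      (Q := LinearMap.ker (φ : IndEigenspace P S lam V hS →ₗ[F] V)) (fun a n hn => by
        change φ ⁅(a : L), n⁆ = 0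
        have h0 : φ n = 0 := hn
        rw [LieModuleHom.map_lie, h0, lie_zero]) hker
    obtain ⟨w, rfl⟩ := mem_of_shiftedOp_eq_zero
      (f := (LieModule.toEnd F L (IndEigenspace P S lam V hS) : L →ₗ[F] Module.End F _))
      (W := LinearMap.range j) (lam := lam) (toEnd_lie (IndEigenspace P S lam V hS)) hWI e y hey
      (h := fun x => x ∈ stabilizer lam)
      (by
        rintro x hx _ ⟨w, rfl⟩
        exact ⟨_, (hlie ⟨x, hx⟩ w).symm⟩)
      hL (Ind.isSRepresentation P S _ hH _ hM).pow_apply hgen hnI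
    have h0 : φ (j w) = 0 := hn
    rw [hφ'] at h0
    apply hn0
    rw [show w = 0 from Subtype.ext h0, map_zero]
  have hsurj : LinearMap.range (φ : IndEigenspace P S lam V hS →ₗ[F] V) = ⊤ := by
    refine eq_top_of_isIrreducible hV (W := (eigenspace lam V : Submodule F V))
      (fun h => hne ((LieSubmodule.toSubmodule_eq_bot _).1 h)) _ ?_ ?_
    · intro v hv
      exact ⟨j ⟨v, hv⟩, hφ' ⟨v, hv⟩⟩
    · rintro x _ ⟨n, rfl⟩
      exact ⟨⁅x, n⁆, LieModuleHom.map_lie φ x n⟩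
  let E := LinearEquiv.ofBijective (φ : IndEigenspace P S lam V hS →ₗ[F] V)
    ⟨LinearMap.ker_eq_bot.1 hinj, LinearMap.range_eq_top.1 hsurj⟩
  exact ⟨LieModuleEquiv.symm { φ with invFun := E.symm, left_inv := E.left_inv,
                                      right_inv := E.right_inv }⟩

end Irreducible

end Induced

/-! ### Common eigenvectors of commuting operators -/

section CommonEigenvector

/-- Commuting endomorphisms over an algebraically closed field have a common eigenvector. -/
theorem exists_common_eigenvector {F V ι : Type*} [Field F] [IsAlgClosed F] [AddCommGroup V]
    [Module F V] [Module.Finite F V] [Nontrivial V] (T : ι → Module.End F V)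
    (hT : ∀ i j v, T i (T j v) = T j (T i v)) :
    ∃ v : V, v ≠ 0 ∧ ∀ i, ∃ c : F, T i v = c • v := by
  let s : Set (Submodule F V) := {U | U ≠ ⊥ ∧ ∀ i, ∀ v ∈ U, T i v ∈ U}
  -- On a minimal nonzero stable subspace each operator is a scalar, since its eigenspaces there are
  -- stable.
  obtain ⟨U, ⟨hU, hTU⟩, hmin⟩ := (wellFounded_lt (α := Submodule F V)).has_min s
    ⟨⊤, top_ne_bot, fun _ _ _ => Submodule.mem_top⟩
  obtain ⟨v, hv, hv0⟩ := U.ne_bot_iff.1 hU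
  refine ⟨v, hv0, fun i => ?_⟩
  have : Nontrivial U := Submodule.nontrivial_iff_ne_bot.2 hU
  obtain ⟨c, hc⟩ := Module.End.exists_eigenvalue ((T i).restrict fun v hv => hTU i v hv)
  obtain ⟨u, hu, hu0⟩ := hc.exists_hasEigenvector
  have hu' : T i u = c • (u : V) := congrArg Subtype.val (Module.End.mem_eigenspace_iff.1 hu)
  let U' : Submodule F V := U ⊓ LinearMap.ker (T i - c • 1)
  have hmem : ∀ w, w ∈ U' ↔ w ∈ U ∧ T i w = c • w := fun w => by
    simp [U', sub_eq_zero]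
  have hU' : U' ∈ s := by
    refine ⟨(Submodule.ne_bot_iff _).2 ⟨u, (hmem u).2 ⟨u.2, hu'⟩, fun h => hu0 (Subtype.ext h)⟩,
      fun j w hw => ?_⟩
    rw [hmem] at hw ⊢
    exact ⟨hTU j w hw.1, by rw [hT, hw.2, map_smul]⟩
  have hle : U' = U := by
    by_contra h
    exact hmin U' hU' (lt_of_le_of_ne inf_le_left h)
  exact ⟨c, ((hmem v).1 (hle ▸ hv)).2⟩

end CommonEigenvector

/-! ### Existence of the character -/

section Character

variable {F : Type u} [Field F] {p : ℕ} {L : Type v} [LieRing L] [LieAlgebra F L]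
  [Module.Finite F L] (P : PMapping F p L) {V : Type w} [AddCommGroup V] [Module F V]
  [LieRingModule L V] [LieModule F L V]

/-- An irreducible module is finite over any commutative algebra `K` of `L`-endomorphisms that
contains all `x ^ p - x^{[p]}`. -/
theorem finite_of_isIrreducible (hV : LieModule.IsIrreducible F L V) (hp : 2 ≤ p)
    {K : Type*} [CommRing K] [Algebra F K] [Module K V] [IsScalarTower F K V]
    (hcomm : ∀ (k : K) (x : L) (v : V), ⁅x, k • v⁆ = k • ⁅x, v⁆) {z : L → K}
    (hz : ∀ (x : L) (v : V),
      ((LieModule.toEnd F L V x) ^ p) v = ⁅P.toFun x, v⁆ + z x • v) :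
    Module.Finite K V := by
  have : Nontrivial V := (LieSubmodule.nontrivial_iff F L V).1 hV.toNontrivial
  obtain ⟨v, hv⟩ := exists_ne (0 : V)
  let f : L →ₗ[F] Module.End K V :=
    { toFun := fun x =>
        { toFun := fun v => ⁅x, v⁆
          map_add' := lie_add x
          map_smul' := fun k v => hcomm k x v }
      map_add' := fun x y => by ext v; exact add_lie x y v
      map_smul' := fun c x => by ext v; exact smul_lie c x v }
  have hpow : ∀ (x : L) (n : ℕ) (v : V), ((f x) ^ n) v = ((LieModule.toEnd F L V x) ^ n) v := by
    intro x n
    induction n with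
    | zero => intro v; rfl
    | succ n ih => intro v; rw [pow_succ, pow_succ, Module.End.mul_apply, ih]; rfl
  let b := Module.finBasis F L
  -- The filtration over `K` starting from a cyclic `W`: only 0 is taken as stabilizing, and the `e
  -- i` are a full basis of `L`.
  refine finite_of_generates (f := f) (W := Submodule.span K {v}) (fun x y => ?_) b
    (h := fun x => x = 0) (fun x hx n hn => ?_) (fun x => ⟨0, rfl, b.repr x, ?_⟩) hp
    (P := P.toFun) (z := z) (fun x n => ?_) (Submodule.fg_span_singleton v) fun Q hQ hL => ?_
  · ext n
    exact lie_lie x y n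
  · rw [hx, map_zero]; exact Submodule.zero_mem _
  · rw [zero_add, b.sum_repr]
  · rw [hpow, hz]; rfl
  · have h : (F ∙ v) ≠ ⊥ := by rwa [Ne, Submodule.span_singleton_eq_bot]
    have htop := eq_top_of_isIrreducible hV h (Q.restrictScalars F)
      ((Submodule.span_singleton_le_iff_mem _ _).2 (hQ (Submodule.mem_span_singleton_self v)))
      fun x n hn => hL x n hn
    exact (Submodule.restrictScalars_eq_top_iff F K V).1 htop

omit [LieAlgebra F L] [Module.Finite F L] [LieModule F L V] in
/-- A commutative algebra of `L`-endomorphisms over which an irreducible module is finite is a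
field. -/
theorem isField_of_isIrreducible (hV : LieModule.IsIrreducible F L V)
    {K : Type*} [CommRing K] [Algebra F K] [Module K V] [IsScalarTower F K V] [FaithfulSMul K V]
    [Module.Finite K V] (hcomm : ∀ (k : K) (x : L) (v : V), ⁅x, k • v⁆ = k • ⁅x, v⁆) :
    IsField K := by
  have : Nontrivial V := (LieSubmodule.nontrivial_iff F L V).1 hV.toNontrivial
  have hzero : ∀ k : K, (∀ v : V, k • v = 0) → k = 0 := fun k hk =>
    eq_of_smul_eq_smul fun v : V => by rw [hk, zero_smul]
  have : Nontrivial K := by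
    by_contra h
    rw [not_nontrivial_iff_subsingleton] at h
    obtain ⟨v, hv⟩ := exists_ne (0 : V)
    exact hv (by rw [← one_smul K v, Subsingleton.elim (1 : K) 0, zero_smul])
  refine ⟨⟨0, 1, zero_ne_one⟩, mul_comm, fun {k} hk => ?_⟩
  let R : Submodule F V := LinearMap.range
    ({ toFun := fun v => k • v, map_add' := smul_add k, map_smul' := fun c v => smul_comm k c v } :
      V →ₗ[F] V)
  have hR : R ≠ ⊥ := by
    intro h
    refine hk (hzero k fun v => ?_)
    have : k • v ∈ R := ⟨v, rfl⟩
    rwa [h, Submodule.mem_bot] at this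
  have htop := eq_top_of_isIrreducible hV hR R le_rfl (by
    rintro x _ ⟨v, rfl⟩
    exact ⟨⁅x, v⁆, (hcomm k x v).symm⟩)
  -- Since kV = V, Nakayama gives r ≡ 1 mod k that annihilates `V`. By faithfulness r = 0, so `k`
  -- divides -1.
  obtain ⟨r, hr, hr0⟩ := Submodule.exists_sub_one_mem_and_smul_eq_zero_of_fg_of_le_smul
    (Ideal.span {k}) (⊤ : Submodule K V) Module.Finite.fg_top (by
      intro v _
      have : v ∈ R := htop ▸ Submodule.mem_top
      obtain ⟨v', rfl⟩ := this
      exact Submodule.smul_mem_smul (Ideal.mem_span_singleton_self k) Submodule.mem_top)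
  rw [hzero r fun v => hr0 v trivial, zero_sub, Ideal.mem_span_singleton] at hr
  obtain ⟨c, hc⟩ := hr
  exact ⟨-c, by rw [mul_neg, ← hc, neg_neg]⟩

variable [Fact p.Prime] [CharP F p]

variable (V) in
/-- The operator `ρ(x) ^ p - ρ(x^{[p]})`. -/
def pCharacterOp (x : L) : Module.End F V :=
  (LieModule.toEnd F L V x) ^ p - LieModule.toEnd F L V (P.toFun x)

omit [Module.Finite F L] in
-- In characteristic `p`, ad(a)^p = ad(a^p). On the image of `L` the left side is also bracketing
-- with the image of x^{[p]}.
theorem pCharacterOp_comm [Nontrivial V] (x y : L) :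
    Commute (pCharacterOp P V x) (LieModule.toEnd F L V y) := by
  set a := LieModule.toEnd F L V x with ha
  have : CharP (Module.End F (Module.End F V)) p :=
    charP_of_injective_algebraMap (algebraMap F _).injective p
  have h1 : (LieAlgebra.ad F (Module.End F V) a) ^ p = LieAlgebra.ad F (Module.End F V) (a ^ p) := by
    have hcomm : Commute (LinearMap.mulLeft F a) (LinearMap.mulRight F a) :=
      LinearMap.ext fun b => (mul_assoc a b a).symm
    have h := LieAlgebra.ad_eq_lmul_left_sub_lmul_right (R := F) (Module.End F V)
    have ha := congrFun h a
    have hap := congrFun h (a ^ p)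
    rw [ha, hap, Pi.sub_apply, Pi.sub_apply, sub_pow_char_of_commute _ hcomm,
      LinearMap.pow_mulLeft, LinearMap.pow_mulRight]
  have h2 : ∀ (n : ℕ) (y : L), ((LieAlgebra.ad F (Module.End F V) a) ^ n)
      (LieModule.toEnd F L V y) = LieModule.toEnd F L V (((LieAlgebra.ad F L x) ^ n) y) := by
    intro n
    induction n with
    | zero => intro y; rfl
    | succ n ih =>
      intro y
      rw [pow_succ, pow_succ, Module.End.mul_apply, Module.End.mul_apply, LieAlgebra.ad_apply,
        LieAlgebra.ad_apply, ha, ← LieHom.map_lie, ← ih]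
  have h3 := h2 p y
  rw [h1, ← P.ad_toFun, LieAlgebra.ad_apply, LieAlgebra.ad_apply, LieHom.map_lie] at h3
  have h4 : ⁅pCharacterOp P V x, LieModule.toEnd F L V y⁆ = 0 := by
    rw [pCharacterOp, sub_lie, h3, sub_self]
  rwa [LieRing.of_associative_ring_bracket, sub_eq_zero] at h4

omit [Module.Finite F L] in
-- Jacobson's formula in End(V) has the same correction terms as the additivity axiom of the
-- `p`-mapping, and they cancel.
theorem pCharacterOp_add (x y : L) :
    pCharacterOp P V (x + y) = pCharacterOp P V x + pCharacterOp P V y := by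
  have h : LieModule.toEnd F L V (∑ i ∈ Finset.Icc 1 (p - 1), jacobsonCoeff F p i x y) =
      ∑ i ∈ Finset.Icc 1 (p - 1),
        jacobsonCoeff F p i (LieModule.toEnd F L V x) (LieModule.toEnd F L V y) := by
    rw [map_sum]
    exact Finset.sum_congr rfl fun i _ => map_jacobsonCoeff _ i x y
  rw [pCharacterOp, P.map_add, map_add, map_add, map_add, h, add_pow_char_eq_jacobson F p,
    pCharacterOp, pCharacterOp]
  abel

omit [Module.Finite F L] [Fact p.Prime] [CharP F p] in
theorem pCharacterOp_smul (c : F) (x : L) :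
    pCharacterOp P V (c • x) = c ^ p • pCharacterOp P V x := by
  rw [pCharacterOp, P.map_smul, map_smul, map_smul, smul_pow, ← smul_sub, pCharacterOp]

variable [IsAlgClosed F]

/-- On an irreducible module over an algebraically closed field, `x ^ p - x^{[p]}` acts by a
scalar. -/
theorem exists_pCharacterOp_eq_smul (hV : LieModule.IsIrreducible F L V) (x : L) :
    ∃ c : F, pCharacterOp P V x = c • 1 := by
  have hnt : Nontrivial V := (LieSubmodule.nontrivial_iff F L V).1 hV.toNontrivial
  let b := Module.finBasis F L
  -- A basis suffices by p-semilinearity, and its finiteness makes the algebra of finite type.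
  let s : Set (Module.End F V) := Set.range fun i => pCharacterOp P V (b i)
  have hcomm : ∀ k ∈ Algebra.adjoin F s, ∀ x, Commute k (LieModule.toEnd F L V x) := by
    intro k hk x
    induction hk using Algebra.adjoin_induction with
    | mem k hk => obtain ⟨i, rfl⟩ := hk; exact pCharacterOp_comm P _ _
    | algebraMap c => exact Algebra.commute_algebraMap_left c _
    | add a b _ _ ha hb => exact ha.add_left hb
    | mul a b _ _ ha hb => exact ha.mul_left hb
  have hzero : pCharacterOp P V (0 : L) = 0 := by
    have h := pCharacterOp_add P (V := V) (0 : L) 0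
    rwa [add_zero, left_eq_add] at h
  have hmem : ∀ x, pCharacterOp P V x ∈ Algebra.adjoin F s := by
    intro x
    have hx : x ∈ Submodule.span F (Set.range b) := by rw [b.span_eq]; trivial
    induction hx using Submodule.span_induction with
    | mem x hx => obtain ⟨i, rfl⟩ := hx; exact Algebra.subset_adjoin ⟨i, rfl⟩
    | zero => rw [hzero]; exact Subalgebra.zero_mem _
    | add x y _ _ hx hy => rw [pCharacterOp_add]; exact Subalgebra.add_mem _ hx hy
    | smul c x _ hx => rw [pCharacterOp_smul]; exact Subalgebra.smul_mem _ hx _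
  have hs : ∀ k ∈ s, ∀ k' ∈ s, k * k' = k' * k := by
    rintro k hk _ ⟨i, rfl⟩
    have h := fun x => hcomm k (Algebra.subset_adjoin hk) x
    exact ((h (b i)).pow_right p).sub_right (h _)
  let _ : CommRing (Algebra.adjoin F s) :=
    { (Algebra.adjoin F s).toRing with
      mul_comm := fun a b => (Algebra.isMulCommutative_adjoin F hs).is_comm.comm a b }
  have hlie : ∀ (k : Algebra.adjoin F s) (x : L) (v : V), ⁅x, k • v⁆ = k • ⁅x, v⁆ := fun k x v =>
    (LinearMap.congr_fun (hcomm k k.2 x) v).symm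
  have hfin : Module.Finite (Algebra.adjoin F s) V :=
    finite_of_isIrreducible P hV (Fact.out : p.Prime).two_le hlie
      (z := fun x => ⟨pCharacterOp P V x, hmem x⟩) fun x v => by
        change _ = LieModule.toEnd F L V (P.toFun x) v + pCharacterOp P V x v
        rw [pCharacterOp, LinearMap.sub_apply, add_sub_cancel]
  have hfield : IsField (Algebra.adjoin F s) := isField_of_isIrreducible hV hlie
  let _ : Field (Algebra.adjoin F s) := hfield.toField
  have hft : Algebra.FiniteType F (Algebra.adjoin F s) :=
    (Subalgebra.fg_iff_finiteType _).1 (Subalgebra.fg_def.2 ⟨s, Set.finite_range _, rfl⟩)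
  -- Zariski's lemma: a field of finite type over `F` is finite over `F`.
  have := finite_of_finite_type_of_isJacobsonRing F (Algebra.adjoin F s)
  obtain ⟨c, hc⟩ := (IsAlgClosed.algebraMap_bijective_of_isIntegral
    (k := F) (K := Algebra.adjoin F s)).2 ⟨pCharacterOp P V x, hmem x⟩
  refine ⟨c, ?_⟩
  rw [← Algebra.algebraMap_eq_smul_one]
  exact (congrArg Subtype.val hc).symm

/-- An irreducible module over an algebraically closed field has a character. -/
theorem exists_isSRepresentation (hV : LieModule.IsIrreducible F L V) :
    ∃ S : Module.Dual F L, IsSRepresentation P S V := by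
  have hnt : Nontrivial V := (LieSubmodule.nontrivial_iff F L V).1 hV.toNontrivial
  have hp : p.Prime := Fact.out
  have h : ∀ x, ∃ c : F, pCharacterOp P V x = c ^ p • 1 := by
    intro x
    obtain ⟨c, hc⟩ := exists_pCharacterOp_eq_smul P hV x
    obtain ⟨d, rfl⟩ := IsAlgClosed.exists_pow_nat_eq c hp.pos
    exact ⟨d, hc⟩
  choose S hS using h
  -- The p-th roots are unique, so taking them turns a p-semilinear form into a linear one.
  have hinj : ∀ a b : F, a ^ p • (1 : Module.End F V) = b ^ p • 1 → a = b := by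
    intro a b hab
    exact frobenius_inj F p (smul_left_injective F one_ne_zero hab)
  refine ⟨{ toFun := S, map_add' := fun x y => hinj _ _ ?_, map_smul' := fun c x => hinj _ _ ?_ },
    fun x => hS x⟩
  · rw [← hS, pCharacterOp_add, hS, hS, add_pow_char, add_smul]
  · rw [← hS, pCharacterOp_smul, hS, smul_smul, RingHom.id_apply, smul_eq_mul, mul_pow]

end Character

/-! ### Existence of λ -/

section Weight

variable {F : Type u} [Field F] {L : Type v} [LieRing L] [LieAlgebra F L] {I : LieIdeal F L}
  {V : Type w} [AddCommGroup V] [Module F V] [LieRingModule L V] [LieModule F L V]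

/-- By the Leibniz rule [I, I], given only as an ideal of `I`, is stable under all of `L`. -/
theorem lie_mem_derivedSeries_one (x : L) {y : I} (hy : y ∈ LieAlgebra.derivedSeries F I 1) :
    ⁅x, y⁆ ∈ LieAlgebra.derivedSeries F I 1 := by
  rw [LieAlgebra.derivedSeries_def, LieAlgebra.derivedSeriesOfIdeal_succ,
    LieAlgebra.derivedSeriesOfIdeal_zero] at hy ⊢
  rw [← LieSubmodule.mem_toSubmodule, LieSubmodule.lieIdeal_oper_eq_linear_span'] at hy
  induction hy using Submodule.span_induction with
  | mem y hy =>
    obtain ⟨a, _, b, _, rfl⟩ := hy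
    have h : ⁅x, ⁅a, b⁆⁆ = ⁅⁅x, a⁆, b⁆ + ⁅a, ⁅x, b⁆⁆ :=
      Subtype.ext (leibniz_lie x (a : L) (b : L))
    rw [h]
    exact add_mem (LieSubmodule.lie_mem_lie (LieSubmodule.mem_top _) (LieSubmodule.mem_top _))
      (LieSubmodule.lie_mem_lie (LieSubmodule.mem_top _) (LieSubmodule.mem_top _))
  | zero => rw [lie_zero]; exact zero_mem _
  | add a b _ _ ha hb => rw [lie_add]; exact add_mem ha hb
  | smul c a _ ha => rw [lie_smul]; exact SMulMemClass.smul_mem c ha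

/-- If `I^{(1)}` acts nilpotently on an irreducible module, it acts by zero. -/
theorem derivedSeries_one_lie_eq_zero [Module.Finite F V] (hV : LieModule.IsIrreducible F L V)
    (hI : ∀ y ∈ LieAlgebra.derivedSeries F I 1, IsNilpotent (LieModule.toEnd F L V (y : L)))
    {y : I} (hy : y ∈ LieAlgebra.derivedSeries F I 1) (v : V) : ⁅(y : L), v⁆ = 0 := by
  have hnt : Nontrivial V := (LieSubmodule.nontrivial_iff F L V).1 hV.toNontrivial
  -- Engel's theorem yields a nonzero vector killed by I^{(1)}; such vectors form an `L`-submodule,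
  -- hence all of `V`.
  have hnil : LieModule.IsNilpotent (LieAlgebra.derivedSeries F I 1) V :=
    (LieModule.isNilpotent_iff_forall' (R := F)).2 fun y => hI y y.2
  have := LieModule.nontrivial_max_triv_of_isNilpotent F (LieAlgebra.derivedSeries F I 1) V
  obtain ⟨⟨n, hn⟩, hn0⟩ :=
    exists_ne (0 : LieModule.maxTrivSubmodule F (LieAlgebra.derivedSeries F I 1) V)
  let Q : Submodule F V :=
    { carrier := {v | ∀ y ∈ LieAlgebra.derivedSeries F I 1, ⁅(y : L), v⁆ = 0}
      zero_mem' := fun y _ => lie_zero _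
      add_mem' := fun {a b} ha hb y hy => by rw [lie_add, ha y hy, hb y hy, add_zero]
      smul_mem' := fun c a ha y hy => by rw [lie_smul, ha y hy, smul_zero] }
  have hnQ : n ∈ Q := fun y hy => hn ⟨y, hy⟩
  have hQ : Q ≠ ⊥ := Q.ne_bot_iff.2 ⟨n, hnQ, fun h => hn0 (Subtype.ext h)⟩
  have htop := eq_top_of_isIrreducible hV hQ Q le_rfl fun x v hv y hy => by
    have h1 : ⁅(y : L), ⁅x, v⁆⁆ = ⁅x, ⁅(y : L), v⁆⁆ - ⁅((⁅x, y⁆ : I) : L), v⁆ := by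
      change _ = _ - ⁅⁅x, (y : L)⁆, v⁆
      rw [lie_lie, sub_sub_cancel]
    rw [h1, hv y hy, hv _ (lie_mem_derivedSeries_one x hy), lie_zero, sub_zero]
  have hv : v ∈ Q := htop ▸ Submodule.mem_top
  exact hv y hy

/-- As I^{(1)} acts by zero, `I` acts by commuting operators. The eigenvalues on a common
eigenvector are linear in the element of `I` and vanish on I^{(1)}. -/
theorem exists_eigenspace_ne_bot [IsAlgClosed F] [Module.Finite F V]
    (hV : LieModule.IsIrreducible F L V)
    (hI : ∀ y ∈ LieAlgebra.derivedSeries F I 1, IsNilpotent (LieModule.toEnd F L V (y : L))) :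
    ∃ lam : Module.Dual F I, VanishesOnDerived lam ∧ eigenspace lam V ≠ ⊥ := by
  have hnt : Nontrivial V := (LieSubmodule.nontrivial_iff F L V).1 hV.toNontrivial
  obtain ⟨v, hv, hc⟩ := exists_common_eigenvector
    (fun y : I => LieModule.toEnd F L V (y : L)) fun a b v => by
      have hab : ⁅a, b⁆ ∈ LieAlgebra.derivedSeries F I 1 := by
        rw [LieAlgebra.derivedSeries_def, LieAlgebra.derivedSeriesOfIdeal_succ,
          LieAlgebra.derivedSeriesOfIdeal_zero]
        exact LieSubmodule.lie_mem_lie (LieSubmodule.mem_top _) (LieSubmodule.mem_top _)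
      have h := derivedSeries_one_lie_eq_zero hV hI hab v
      rw [LieIdeal.coe_bracket_of_module, LieSubmodule.coe_bracket, lie_lie] at h
      exact sub_eq_zero.1 h
  choose c hc using hc
  have hinj : ∀ a b : F, a • v = b • v → a = b := fun a b h => smul_left_injective F hv h
  refine ⟨{ toFun := c, map_add' := fun x y => hinj _ _ ?_, map_smul' := fun r x => hinj _ _ ?_ },
    fun y hy => hinj _ _ ?_, ?_⟩
  · rw [← hc, add_smul, ← hc, ← hc]
    exact add_lie (x : L) (y : L) v
  · rw [← hc, RingHom.id_apply, smul_eq_mul, mul_smul, ← hc]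
    exact smul_lie r (x : L) v
  · refine (hc y).symm.trans ?_
    rw [zero_smul]
    exact derivedSeries_one_lie_eq_zero hV hI hy v
  · intro h
    exact hv ((LieSubmodule.mem_bot v).1 (h.le fun y => hc y))

end Weight

end RestrictedLie

end

open RestrictedLie in
theorem mainTheorem4 (F : Type*) [Field F] (p : ℕ) [Fact p.Prime] [CharP F p]
    (L : Type*) [LieRing L] [LieAlgebra F L] [Module.Finite F L] (P : PMapping F p L)
    (V : Type*) [AddCommGroup V] [Module F V] [LieRingModule L V] [LieModule F L V]
    (hV : LieModule.IsIrreducible F L V) (I : LieIdeal F L) :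
    (∀ (S : Module.Dual F L) (hS : IsSRepresentation P S V) (lam : Module.Dual F I),
      VanishesOnDerived lam → eigenspace lam V ≠ ⊥ →
        Nonempty (V ≃ₗ⁅F,L⁆ IndEigenspace P S lam V hS) ∧
        LieModule.IsIrreducible F (stabilizer lam) (eigenspace lam V)) ∧
    (IsAlgClosed F →
      (∀ y ∈ LieAlgebra.derivedSeries F I 1, IsNilpotent (LieModule.toEnd F L V (y : L))) →
        ∃ (S : Module.Dual F L) (hS : IsSRepresentation P S V) (lam : Module.Dual F I),
          VanishesOnDerived lam ∧ eigenspace lam V ≠ ⊥ ∧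
          Nonempty (V ≃ₗ⁅F,L⁆ IndEigenspace P S lam V hS) ∧
          LieModule.IsIrreducible F (stabilizer lam) (eigenspace lam V)) := by
  refine ⟨fun S hS lam hlam hne => ⟨nonempty_equiv_indEigenspace hV hS hlam hne,
    isIrreducible_eigenspace hV hS hne⟩, fun _ hI => ?_⟩
  obtain ⟨S, hS⟩ := exists_isSRepresentation P hV
  -- With a character at hand the scalars themselves serve as `K`, so `V` is finite-dimensional.
  have : Module.Finite F V := finite_of_isIrreducible P hV (Fact.out : p.Prime).two_le
    (K := F) (fun k x v => lie_smul k x v) hS.pow_apply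
  obtain ⟨lam, hlam, hne⟩ := exists_eigenspace_ne_bot hV hI
  exact ⟨S, hS, lam, hlam, hne, nonempty_equiv_indEigenspace hV hS hlam hne,
    isIrreducible_eigenspace hV hS hne⟩
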